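/- Let $G$ be a (real) Banach Lie group and let $H\subset G$ be a closed Banach Lie subgroup: $H$ is closed in $G$, it is a Banach Lie group in the subspace topology, and the inclusion $H\to G$ is smooth with a differential at the identity that is injective with closed image (the image need not be complemented). Let $M$ be a topological space and let $\pi\colon P\to M$ be a principal $G$-bundle over $M$, that is: $\pi$ is a continuous surjection, $G$ acts continuously and freely on the right of $P$, the orbits are the fibres of $\pi$, and every point of $M$ has an open neighbourhood $U$ with a $G$-equivariant homeomorphism $\pi^{-1}(U)\cong U\times G$ over $U$. Say that the structure group of $P$ reduces to $H$ if there are a principal $H$-bundle $Q$ over $M$ and a continuous $H$-equivariant map $Q\to P$ covering the identity of $M$. Then the following hold. (1) The structure group of $P$ reduces to $H$ if and only if the map $P/H\to M$ induced by $\pi$ has a global continuous section. (2) Let $EG\to BG$ be a classifying space for principal $G$-bundles, i.e. a principal $G$-bundle such that for every principal $G$-bundle $R$ over a CW complex $X$ there is a continuous map $X\to BG$, unique up to homotopy, along which $EG$ pulls back to a bundle isomorphic to $R$. Let $f\colon M\to BG$ be a classifying map for $P$, i.e. a continuous map with $f^*(EG)\cong P$. Then the structure group of $P$ reduces to $H$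 if and only if $f$ lifts to $BH=EG/H$, i.e. there is a continuous map $\hat f\colon M\to EG/H$ whose composition with the projection $EG/H\to BG$ is $f$. (3) If $H$ is normal in $G$, then the structure group of $P$ reduces to $H$ if and only if $\rho[P]$ is the trivial class, where $[P]\in H^1(M,\underline G)$ is the class of the transition functions of $P$ in the first Čech cohomology set (the direct limit over all open covers of $M$) with values in the sheaf of continuous $G$-valued functions, and $\rho\colon H^1(M,\underline G)\to H^1(M,\underline{G/H})$ is induced by the canonical projection $G\to G/H$. -/

import Mathlib

open Topology
open scoped Manifold ContDiff

universe u v w w'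

/-! ### Principal bundles -/

/-- A (topological) principal `G`-bundle over the topological space `M`. The right action of `G` on
the total space is an action of `Gᵐᵒᵖ`, so that `p · g` is `MulOpposite.op g • p`. A local
trivialization over an open set `U` of the base is a homeomorphism of the part of the bundle
over `U` with `U × G`, of the form `p ↦ (π p, s p)` with `s (p · g) = s p * g`. -/
structure PrincipalBundle (M : Type u) [TopologicalSpace M] (G : Type v) [TopologicalSpace G]
    [Group G] where
  /-- the total space -/
  Total : Type w
  [topTotal : TopologicalSpace Total]
  [rightAction : MulAction Gᵐᵒᵖ Total]
  /-- the bundle projection -/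
  proj : Total → M
  continuous_proj : Continuous proj
  surjective_proj : Function.Surjective proj
  continuous_act : Continuous fun x : Total × G => MulOpposite.op x.2 • x.1
  free : ∀ (p : Total) (g : G), MulOpposite.op g • p = p → g = 1
  proj_eq_iff : ∀ p q : Total, proj p = proj q ↔ ∃ g : G, MulOpposite.op g • p = q
  locally_trivial : ∀ m : M, ∃ e : Bundle.Trivialization G proj, m ∈ e.baseSet ∧
    ∀ p ∈ e.source, ∀ g : G, (e (MulOpposite.op g • p)).2 = (e p).2 * g

namespace PrincipalBundle

attribute [instance] PrincipalBundle.topTotal PrincipalBundle.rightAction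

section Basic

variable {M : Type u} [TopologicalSpace M] {G : Type v} [TopologicalSpace G] [Group G]

theorem proj_act (P : PrincipalBundle.{u, v, w} M G) (p : P.Total) (g : G) :
    P.proj (MulOpposite.op g • p) = P.proj p :=
  ((P.proj_eq_iff _ _).2 ⟨g, rfl⟩).symm

/-- Two principal `G`-bundles over `M` are isomorphic if there is a `G`-equivariant homeomorphism
of the total spaces that covers the identity of `M`. -/
def IsIso (P : PrincipalBundle.{u, v, w} M G) (Q : PrincipalBundle.{u, v, w'} M G) : Prop :=
  ∃ φ : P.Total ≃ₜ Q.Total, (∀ p, Q.proj (φ p) = P.proj p) ∧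
    ∀ (p : P.Total) (g : G), φ (MulOpposite.op g • p) = MulOpposite.op g • φ p

/-! ### Pull-back of a principal bundle -/

section Pullback

variable {N : Type u} [TopologicalSpace N]

/-- The total space `{(p, n) | π p = f n}` of the pull-back bundle, a subspace of `P × N`. -/
abbrev PullbackTotal (P : PrincipalBundle.{u, v, w} M G) (f : C(N, M)) : Type (max u w) :=
  {x : P.Total × N // P.proj x.1 = f x.2}

/-- The action `(p, n) · g = (p · g, n)` on the pull-back. -/
instance pullbackAction (P : PrincipalBundle.{u, v, w} M G) (f : C(N, M)) :
    MulAction Gᵐᵒᵖ (P.PullbackTotal f) where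
  smul g x := ⟨(g • x.1.1, x.1.2), by
    have h := P.proj_act x.1.1 g.unop
    rw [MulOpposite.op_unop] at h
    exact h.trans x.2⟩
  one_smul x := Subtype.ext (Prod.ext (one_smul _ _) rfl)
  mul_smul a b x := Subtype.ext (Prod.ext (mul_smul _ _ _) rfl)

/-- The local trivialization of the pull-back which is induced by a local trivialization. -/
noncomputable def pullbackTriv (P : PrincipalBundle.{u, v, w} M G) (f : C(N, M))
    (e : Bundle.Trivialization G P.proj) :
    Bundle.Trivialization G (fun x : P.PullbackTotal f => x.1.2) where
  toFun x := (x.1.2, (e x.1.1).2)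
  invFun y := by
    classical
    exact if h : f y.1 ∈ e.baseSet then
      ⟨(e.toOpenPartialHomeomorph.symm (f y.1, y.2), y.1), e.proj_symm_apply' h⟩
    else ⟨((P.surjective_proj (f y.1)).choose, y.1), (P.surjective_proj (f y.1)).choose_spec⟩
  source := {x | f x.1.2 ∈ e.baseSet}
  target := (f ⁻¹' e.baseSet) ×ˢ Set.univ
  map_source' x hx := ⟨hx, trivial⟩
  map_target' y hy := by
    have h : f y.1 ∈ e.baseSet := hy.1
    simp [h]
  left_inv' x hx := by
    have h : f x.1.2 ∈ e.baseSet := hx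
    have h' : x.1.1 ∈ e.source := by rw [e.mem_source, x.2]; exact h
    simp only [h, dif_pos]
    apply Subtype.ext
    apply Prod.ext
    · change e.toOpenPartialHomeomorph.symm (f x.1.2, (e x.1.1).2) = x.1.1
      rw [← x.2]
      exact e.symm_apply_mk_proj h'
    · rfl
  right_inv' y hy := by
    have h : f y.1 ∈ e.baseSet := hy.1
    simp only [h, dif_pos]
    exact Prod.ext rfl (by simp [e.apply_symm_apply' h])
  open_source := e.open_baseSet.preimage (by fun_prop)
  open_target := (e.open_baseSet.preimage f.continuous).prod isOpen_univ
  continuousOn_toFun := by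
    refine ContinuousOn.prodMk (by fun_prop) ?_
    refine continuous_snd.comp_continuousOn (e.continuousOn_toFun.comp
      (by fun_prop : Continuous fun x : P.PullbackTotal f => x.1.1).continuousOn ?_)
    intro x hx
    change x.1.1 ∈ e.source
    rw [e.mem_source, x.2]
    exact hx
  continuousOn_invFun := by
    refine Topology.IsInducing.subtypeVal.continuousOn_iff.2 ?_
    have key : ContinuousOn
        (fun y : N × G => (e.toOpenPartialHomeomorph.symm (f y.1, y.2), y.1))
        ((f ⁻¹' e.baseSet) ×ˢ Set.univ) := by
      refine ContinuousOn.prodMk ?_ (by fun_prop)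
      refine e.toOpenPartialHomeomorph.continuousOn_symm.comp
        (by fun_prop : Continuous fun y : N × G => (f y.1, y.2)).continuousOn ?_
      intro y hy
      exact e.mem_target.2 hy.1
    refine key.congr ?_
    intro y hy
    have h : f y.1 ∈ e.baseSet := hy.1
    simp [h]
  baseSet := f ⁻¹' e.baseSet
  open_baseSet := e.open_baseSet.preimage f.continuous
  source_eq := rfl
  target_eq := rfl
  proj_toFun _ _ := rfl

/-- The pull-back `f^* P` of a principal bundle along a continuous map. -/
noncomputable def pullback (P : PrincipalBundle.{u, v, w} M G) (f : C(N, M)) :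
    PrincipalBundle.{u, v, max u w} N G where
  Total := P.PullbackTotal f
  proj x := x.1.2
  continuous_proj := by fun_prop
  surjective_proj n :=
    ⟨⟨((P.surjective_proj (f n)).choose, n), (P.surjective_proj (f n)).choose_spec⟩, rfl⟩
  continuous_act := by
    refine Continuous.subtype_mk (Continuous.prodMk ?_ (by fun_prop)) _
    exact P.continuous_act.comp
      (by fun_prop : Continuous fun x : P.PullbackTotal f × G => (x.1.1.1, x.2))
  free x g h := P.free x.1.1 g (congrArg (fun y => y.1.1) h)
  proj_eq_iff x y := by
    constructor
    · intro h
      obtain ⟨g, hg⟩ := (P.proj_eq_iff x.1.1 y.1.1).1 (by rw [x.2, y.2, h])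
      exact ⟨g, Subtype.ext (Prod.ext hg h)⟩
    · rintro ⟨g, rfl⟩
      rfl
  locally_trivial n := by
    obtain ⟨e, he, h⟩ := P.locally_trivial (f n)
    refine ⟨P.pullbackTriv f e, he, fun x hx g => h x.1.1 ?_ g⟩
    rw [e.mem_source, x.2]
    exact hx

end Pullback

/-! ### Reductions, the fibration `P/H → M`, and its sections -/

/-- The structure group of `P` reduces to the subgroup `H` (with the subspace topology): there are
a principal `H`-bundle `Q` over the same base and a bundle map `Q → P`, that is a continuous map
over the identity of the base which is equivariant along the inclusion of `H`. -/
def ReducesTo (P : PrincipalBundle.{u, v, w} M G) (H : Subgroup G) : Prop :=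
  ∃ (Q : PrincipalBundle.{u, v, w} M H) (φ : C(Q.Total, P.Total)),
    (∀ q, P.proj (φ q) = Q.proj q) ∧
    ∀ (q : Q.Total) (h : H),
      φ (MulOpposite.op h • q) = MulOpposite.op (h : G) • φ q

/-- The space `P/H` of the orbits of the right action of `H` on the total space,
with the quotient topology. -/
abbrev OrbitSpace (P : PrincipalBundle.{u, v, w} M G) (H : Subgroup G) : Type w :=
  Quotient (MulAction.orbitRel H.op P.Total)

/-- The projection `P/H → M` induced by the bundle projection. -/
def orbitProj (P : PrincipalBundle.{u, v, w} M G) (H : Subgroup G) : P.OrbitSpace H → M :=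
  Quotient.lift P.proj (by
    rintro _ q ⟨⟨h, hh⟩, rfl⟩
    exact P.proj_act q h.unop)

/-- `P/H → M` has a global continuous section. -/
def HasGlobalSection (P : PrincipalBundle.{u, v, w} M G) (H : Subgroup G) : Prop :=
  ∃ σ : C(M, P.OrbitSpace H), ∀ m, P.orbitProj H (σ m) = m

/-- The map `f` into the base of `P` lifts to `P/H`. -/
def LiftsToOrbitSpace (P : PrincipalBundle.{u, v, w} M G) (H : Subgroup G)
    {N : Type u} [TopologicalSpace N] (f : C(N, M)) : Prop :=
  ∃ f' : C(N, P.OrbitSpace H), ∀ n, P.orbitProj H (f' n) = f n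

end Basic

/-! ### Classifying spaces and classifying maps -/

section Classifying

variable {G : Type u} [TopologicalSpace G] [Group G] {B : Type u} [TopologicalSpace B]

/-- `f` is a classifying map for `P` with respect to the principal bundle `E` over `B`
if the pull-back `f^* E` is isomorphic to `P`. -/
def IsClassifyingMap (E : PrincipalBundle.{u, u, u} B G) {M : Type u} [TopologicalSpace M]
    (P : PrincipalBundle.{u, u, u} M G) (f : C(M, B)) : Prop :=
  (E.pullback f).IsIso P

/-- `E` over `B` is a classifying space for principal `G`-bundles: each principal `G`-bundle over a
CW complex has a classifying map to `B`, and this map is unique up to homotopy. -/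
def IsClassifyingSpace (E : PrincipalBundle.{u, u, u} B G) : Prop :=
  ∀ (X : Type u) [TopologicalSpace X] [T2Space X] [Topology.CWComplex (Set.univ : Set X)]
    (P : PrincipalBundle.{u, u, u} X G),
    ∃ f : C(X, B), E.IsClassifyingMap P f ∧
      ∀ f' : C(X, B), E.IsClassifyingMap P f' → f.Homotopic f'

end Classifying

end PrincipalBundle

/-! ### Non-abelian Čech cohomology in degree one -/

/-- A Čech 1-cocycle on `M`, with respect to some open cover, for the sheaf of continuous functions
with values in the topological group `K`. Only the values of `g i j` on `U i ∩ U j` matter. -/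
structure CechCocycle (M : Type u) [TopologicalSpace M] (K : Type v) [TopologicalSpace K]
    [Group K] where
  /-- the index set of the cover -/
  ι : Type u
  /-- the cover -/
  U : ι → Set M
  isOpen_U : ∀ i, IsOpen (U i)
  cover : ∀ x, ∃ i, x ∈ U i
  /-- the functions on the overlaps -/
  g : ι → ι → M → K
  continuousOn_g : ∀ i j, ContinuousOn (g i j) (U i ∩ U j)
  cocycle : ∀ i j k, ∀ x ∈ U i ∩ U j ∩ U k, g i j x * g j k x = g i k x

namespace CechCocycle

variable {M : Type u} [TopologicalSpace M] {K : Type v} [TopologicalSpace K] [Group K]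

/-- Two Čech cocycles are cohomologous if on a common refinement `W` of their covers they differ by
the coboundary action of a family of continuous functions `b k` on `W k`. -/
def Cohomologous (c c' : CechCocycle.{u, v} M K) : Prop :=
  ∃ (κ : Type u) (W : κ → Set M) (r : κ → c.ι) (r' : κ → c'.ι) (b : κ → M → K),
    (∀ k, IsOpen (W k)) ∧ (∀ x, ∃ k, x ∈ W k) ∧
    (∀ k, W k ⊆ c.U (r k)) ∧ (∀ k, W k ⊆ c'.U (r' k)) ∧
    (∀ k, ContinuousOn (b k) (W k)) ∧
    ∀ k l, ∀ x ∈ W k ∩ W l,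
      c'.g (r' k) (r' l) x = b k x * c.g (r k) (r l) x * (b l x)⁻¹

theorem cohomologous_equivalence [IsTopologicalGroup K] :
    Equivalence (Cohomologous (M := M) (K := K)) where
  refl c := ⟨c.ι, c.U, id, id, fun _ _ => 1, c.isOpen_U, c.cover, fun _ => subset_rfl,
    fun _ => subset_rfl, fun _ => continuousOn_const, fun _ _ _ _ => by simp⟩
  symm := by
    rintro c c' ⟨κ, W, r, r', b, h1, h2, h3, h4, h5, h6⟩
    refine ⟨κ, W, r', r, fun k x => (b k x)⁻¹, h1, h2, h4, h3, fun k => (h5 k).inv, ?_⟩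
    intro k l x hx
    rw [h6 k l x hx]
    group
  trans := by
    rintro c c' c'' ⟨κ, W, r, r', b, h1, h2, h3, h4, h5, h6⟩
      ⟨κ', W', s, s', b', h1', h2', h3', h4', h5', h6'⟩
    refine ⟨κ × κ', fun k => W k.1 ∩ W' k.2, fun k => r k.1, fun k => s' k.2,
      fun k x => b' k.2 x * c'.g (s k.2) (r' k.1) x * b k.1 x,
      fun k => (h1 _).inter (h1' _), ?_, ?_, ?_, ?_, ?_⟩
    · intro x
      obtain ⟨k, hk⟩ := h2 x
      obtain ⟨k', hk'⟩ := h2' x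
      exact ⟨(k, k'), hk, hk'⟩
    · exact fun k x hx => h3 _ hx.1
    · exact fun k x hx => h4' _ hx.2
    · intro k
      refine ContinuousOn.mul (ContinuousOn.mul ((h5' _).mono fun x hx => hx.2) ?_)
        ((h5 _).mono fun x hx => hx.1)
      exact (c'.continuousOn_g _ _).mono fun x hx => ⟨h3' _ hx.2, h4 _ hx.1⟩
    · rintro ⟨k, k'⟩ ⟨l, l'⟩ x ⟨⟨hk, hk'⟩, hl, hl'⟩
      have a1 := h6 k l x ⟨hk, hl⟩
      have a2 := h6' k' l' x ⟨hk', hl'⟩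
      have a3 := c'.cocycle (s k') (r' k) (r' l) x ⟨⟨h3' _ hk', h4 _ hk⟩, h4 _ hl⟩
      have a4 := c'.cocycle (s k') (r' l) (s l') x ⟨⟨h3' _ hk', h4 _ hl⟩, h3' _ hl'⟩
      have a5 := c'.cocycle (s l') (r' l) (s l') x ⟨⟨h3' _ hl', h4 _ hl⟩, h3' _ hl'⟩
      have a6 := c'.cocycle (s l') (s l') (s l') x ⟨⟨h3' _ hl', h3' _ hl'⟩, h3' _ hl'⟩
      have a7 : c'.g (s l') (s l') x = 1 := by simpa using a6
      have a8 : c'.g (r' l) (s l') x = (c'.g (s l') (r' l) x)⁻¹ := by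
        rw [a7] at a5
        exact (inv_eq_of_mul_eq_one_right a5).symm
      change c''.g (s' k') (s' l') x = _
      rw [a2, ← a4, ← a3, a1, a8]
      group

/-- The constant cocycle `1`, on the cover by the whole space. -/
def one (M : Type u) [TopologicalSpace M] (K : Type v) [TopologicalSpace K] [Group K] :
    CechCocycle.{u, v} M K where
  ι := PUnit
  U _ := Set.univ
  isOpen_U _ := isOpen_univ
  cover _ := ⟨PUnit.unit, trivial⟩
  g _ _ _ := 1
  continuousOn_g _ _ := continuousOn_const
  cocycle _ _ _ _ _ := mul_one 1

/-- The image of a cocycle under a continuous homomorphism. -/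
def map {L : Type w} [TopologicalSpace L] [Group L] (ρ : K →ₜ* L) (c : CechCocycle.{u, v} M K) :
    CechCocycle.{u, w} M L where
  ι := c.ι
  U := c.U
  isOpen_U := c.isOpen_U
  cover := c.cover
  g i j x := ρ (c.g i j x)
  continuousOn_g i j := ρ.continuous_toFun.comp_continuousOn (c.continuousOn_g i j)
  cocycle i j k x hx := by rw [← map_mul, c.cocycle i j k x hx]

end CechCocycle

/-- The relation of being cohomologous. -/
instance cechSetoid (M : Type u) [TopologicalSpace M] (K : Type v) [TopologicalSpace K] [Group K]
    [IsTopologicalGroup K] : Setoid (CechCocycle.{u, v} M K) :=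
  ⟨CechCocycle.Cohomologous, CechCocycle.cohomologous_equivalence⟩

/-- The first Čech cohomology `H¹(M, K)` with values in the sheaf of continuous `K`-valued
functions. -/
def CechH1 (M : Type u) [TopologicalSpace M] (K : Type v) [TopologicalSpace K] [Group K]
    [IsTopologicalGroup K] : Type (max (u + 1) v) :=
  Quotient (cechSetoid.{u, v} M K)

namespace CechH1

variable {M : Type u} [TopologicalSpace M] {K : Type v} [TopologicalSpace K] [Group K]
  [IsTopologicalGroup K]

/-- The base point of the pointed set `H¹(M, K)`. -/
def trivialClass (M : Type u) [TopologicalSpace M] (K : Type v) [TopologicalSpace K] [Group K]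
    [IsTopologicalGroup K] : CechH1 M K :=
  Quotient.mk _ (CechCocycle.one M K)

/-- The map `H¹(M, K) → H¹(M, L)` induced by a continuous homomorphism `K → L`. -/
def map {L : Type w} [TopologicalSpace L] [Group L] [IsTopologicalGroup L] (ρ : K →ₜ* L) :
    CechH1 M K → CechH1 M L :=
  Quotient.map (CechCocycle.map ρ) (by
    rintro c c' ⟨κ, W, r, r', b, h1, h2, h3, h4, h5, h6⟩
    refine ⟨κ, W, r, r', fun k x => ρ (b k x), h1, h2, h3, h4,
      fun k => ρ.continuous_toFun.comp_continuousOn (h5 k), ?_⟩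
    intro k l x hx
    change ρ (c'.g (r' k) (r' l) x) = ρ (b k x) * ρ (c.g (r k) (r l) x) * (ρ (b l x))⁻¹
    rw [h6 k l x hx, map_mul, map_mul, map_inv])

end CechH1

namespace PrincipalBundle

variable {M : Type u} [TopologicalSpace M] {G : Type v} [TopologicalSpace G] [Group G]

/-- The local trivialization `e` commutes with the right action of `G`. -/
def IsEquivariant (P : PrincipalBundle.{u, v, w} M G) (e : Bundle.Trivialization G P.proj) : Prop :=
  ∀ p ∈ e.source, ∀ g : G, (e (MulOpposite.op g • p)).2 = (e p).2 * g

/-- The transition function `g` from the local trivialization `p ↦ (π p, s' p)` to the local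
trivialization `p ↦ (π p, s p)`: on the overlap of their domains `g ∘ π = s s'⁻¹`. -/
noncomputable def transition (P : PrincipalBundle.{u, v, w} M G)
    (e e' : Bundle.Trivialization G P.proj) (m : M) : G :=
  e'.coordChange e m 1

theorem transition_proj (P : PrincipalBundle.{u, v, w} M G)
    {e e' : Bundle.Trivialization G P.proj} (he : P.IsEquivariant e) (he' : P.IsEquivariant e')
    {p : P.Total} (hp : P.proj p ∈ e.baseSet) (hp' : P.proj p ∈ e'.baseSet) :
    P.transition e e' (P.proj p) = (e p).2 * ((e' p).2)⁻¹ := by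
  have h0 := he' p (e'.mem_source.2 hp') ((e' p).2)⁻¹
  rw [mul_inv_cancel] at h0
  have h1 := e'.coordChange_apply_snd e
    (p := MulOpposite.op ((e' p).2)⁻¹ • p) (by rw [P.proj_act]; exact hp')
  rw [h0, P.proj_act, he p (e.mem_source.2 hp)] at h1
  exact h1

theorem continuousOn_transition (P : PrincipalBundle.{u, v, w} M G)
    (e e' : Bundle.Trivialization G P.proj) :
    ContinuousOn (P.transition e e') (e.baseSet ∩ e'.baseSet) := by
  refine continuous_snd.comp_continuousOn (e.continuousOn_toFun.comp
    ((e'.continuousOn_symm_prodMk_left (v := (1 : G))).mono Set.inter_subset_right) ?_)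
  intro m hm
  change e'.toOpenPartialHomeomorph.symm (m, 1) ∈ e.source
  rw [e.mem_source, e'.proj_symm_apply' hm.2]
  exact hm.1

/-- The cocycle of transition functions of a family of local trivializations. -/
noncomputable def transitionCocycle (P : PrincipalBundle.{u, v, w} M G) {ι : Type u}
    (e : ι → Bundle.Trivialization G P.proj) (he : ∀ i, P.IsEquivariant (e i))
    (hc : ∀ m, ∃ i, m ∈ (e i).baseSet) : CechCocycle.{u, v} M G where
  ι := ι
  U i := (e i).baseSet
  isOpen_U i := (e i).open_baseSet
  cover := hc
  g i j := P.transition (e i) (e j)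
  continuousOn_g i j := P.continuousOn_transition (e i) (e j)
  cocycle i j k m hm := by
    obtain ⟨p, rfl⟩ := P.surjective_proj m
    rw [P.transition_proj (he i) (he j) hm.1.1 hm.1.2,
      P.transition_proj (he j) (he k) hm.1.2 hm.2, P.transition_proj (he i) (he k) hm.1.1 hm.2]
    group

/-- The class `[P]` in `H¹(M, G)` of a principal bundle, given by its transition functions. -/
noncomputable def cechClass [IsTopologicalGroup G] (P : PrincipalBundle.{u, v, w} M G) :
    CechH1 M G :=
  Quotient.mk _ (P.transitionCocycle (fun m : M => (P.locally_trivial m).choose)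
    (fun m => (P.locally_trivial m).choose_spec.2)
    (fun m => ⟨m, (P.locally_trivial m).choose_spec.1⟩))

/-- The class `[P]` does not depend on the chosen local trivializations. -/
theorem cechClass_eq [IsTopologicalGroup G] (P : PrincipalBundle.{u, v, w} M G) {ι : Type u}
    (e : ι → Bundle.Trivialization G P.proj) (he : ∀ i, P.IsEquivariant (e i))
    (hc : ∀ m, ∃ i, m ∈ (e i).baseSet) :
    P.cechClass = Quotient.mk _ (P.transitionCocycle e he hc) := by
  apply Quotient.sound
  let t : M → Bundle.Trivialization G P.proj := fun m => (P.locally_trivial m).choose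
  have ht : ∀ m, P.IsEquivariant (t m) := fun m => (P.locally_trivial m).choose_spec.2
  refine ⟨M × ι, fun k => (e k.2).baseSet ∩ (t k.1).baseSet, Prod.fst, Prod.snd,
    fun k => P.transition (e k.2) (t k.1), fun k => (e k.2).open_baseSet.inter
      (t k.1).open_baseSet, ?_, fun k => Set.inter_subset_right, fun k => Set.inter_subset_left,
    fun k => P.continuousOn_transition _ _, ?_⟩
  · intro m
    obtain ⟨i, hi⟩ := hc m
    exact ⟨(m, i), hi, (P.locally_trivial m).choose_spec.1⟩
  · rintro ⟨a, i⟩ ⟨b, j⟩ m ⟨⟨h1, h2⟩, h3, h4⟩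
    obtain ⟨p, rfl⟩ := P.surjective_proj m
    change P.transition (e i) (e j) (P.proj p) = P.transition (e i) (t a) (P.proj p) *
      P.transition (t a) (t b) (P.proj p) * (P.transition (e j) (t b) (P.proj p))⁻¹
    rw [P.transition_proj (he i) (he j) h1 h3, P.transition_proj (he i) (ht a) h1 h2,
      P.transition_proj (ht a) (ht b) h2 h4, P.transition_proj (he j) (ht b) h3 h4]
    group

end PrincipalBundle

/-! ### Closed Banach Lie subgroups -/

/-- The subgroup `H` of the Banach Lie group `G` is a closed Banach Lie subgroup: it is closed, and
`H`, which is itself a Banach Lie group in the subspace topology, is an immersed submanifold: the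
inclusion is smooth, and its differential at `1` identifies the tangent space of `H` with a closed
subspace of the tangent space of `G`. This subspace need not have a closed complement. -/
structure IsClosedBanachLieSubgroup {E : Type*} [NormedAddCommGroup E] [NormedSpace ℝ E]
    {G : Type*} [TopologicalSpace G] [ChartedSpace E G] [Group G]
    {F : Type*} [NormedAddCommGroup F] [NormedSpace ℝ F]
    (H : Subgroup G) [ChartedSpace F H] : Prop where
  isClosed : IsClosed (H : Set G)
  lieGroup : LieGroup 𝓘(ℝ, F) ∞ H
  contMDiff_inclusion : ContMDiff 𝓘(ℝ, F) 𝓘(ℝ, E) ∞ (Subtype.val : H → G)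
  injective_differential :
    Function.Injective (mfderiv 𝓘(ℝ, F) 𝓘(ℝ, E) (Subtype.val : H → G) 1)
  isClosed_range_differential :
    IsClosed (Set.range (mfderiv 𝓘(ℝ, F) 𝓘(ℝ, E) (Subtype.val : H → G) 1))

/-- The canonical projection `G → G/H` for a normal subgroup `H`, as a continuous homomorphism. -/
def quotientHom {G : Type*} [TopologicalSpace G] [Group G] (H : Subgroup G) [H.Normal] :
    G →ₜ* (G ⧸ H) :=
  ⟨QuotientGroup.mk' H, continuous_quot_mk⟩

/-! Everything rests on one fact about groups: `G → G/H` has continuous local sections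
(`hasLocalSections_of_isClosedBanachLieSubgroup`). When the Lie algebra of `H` has a closed
complement, the inverse function theorem gives them. Without a complement there is no slice, and a
selection argument in the style of Michael replaces it. In a chart at `1`, the cosets of `H` are
closed sets that vary lower semicontinuously, because `G → G/H` is open. They are not convex, but a
piece of size `η` of a coset lies within a small multiple of `η` of the image of a ball under an
affine map, and that image is convex. This uses strict differentiability of the multiplication `G ×
H → G` and the lower bound for the differential of `H → G`, which follows from injectivity and
closed range; a projection onto the range is never needed. This almost convexity
(`exists_convexHull_subset_thickening`) suffices for successive approximation with partitions of
unity (`exists_selection_of_almost_convex`). The parameter space is a subset of `G/H`, which is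
pseudometrizable, hence normal and paracompact.

The rest is bundle theory. A section `σ` of `P/H → M` and a reduction determine each other: the
reduction is the set of `p` whose orbit is `σ (π p)`, and it is locally trivial because the
coset-valued local expression of `σ` lifts locally to `G`. For a pull-back `f^* E`, sections of the
orbit space are lifts of `f` to `E/H`. If `H` is normal, the local expressions of `σ` are functions
`c k` to the group `G/H` with `g k l = c k * (c l)⁻¹` modulo `H`, that is, a trivialization of the
image cocycle. -/

/-! ### A selection theorem for almost convex families -/

section Selection

open Metric Filter

variable {X : Type*} [TopologicalSpace X] [NormalSpace X] [ParacompactSpace X]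
  {E : Type*} [NormedAddCommGroup E] [NormedSpace ℝ E]

/-- One step of the approximation: an `η`-approximate selection can be moved by less than `η` to an
`η / 2`-approximate one. -/
theorem exists_better_approximate_selection {T : X → Set E} {a : E} {r : ℝ}
    (hlsc : ∀ x, ∀ p ∈ T x, ∀ ε > 0, ∀ᶠ y in 𝓝 x, ∃ q ∈ T y, dist q p < ε)
    (hconv : ∀ x, ∀ z ∈ ball a r, ∀ η, 0 < η → η < r →
      convexHull ℝ (T x ∩ ball z η) ⊆ thickening (η / 16) (T x))
    {η : ℝ} (hη : 0 < η) (hηr : 2 * η < r) (s : C(X, E)) (hs : ∀ x, s x ∈ ball a r)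
    (happ : ∀ x, ∃ p ∈ T x, dist p (s x) < η) :
    ∃ s' : C(X, E), ∀ x, dist (s' x) (s x) < η ∧ ∃ p ∈ T x, dist p (s' x) < η / 2 := by
  -- The target sets are convex, so locally constant choices glue by a partition of unity. Near `x`
  -- the constant `p` is admissible: a point `q` of `T y` within `η / 8` of `p` is within `2 * η` of
  -- `s y`.
  obtain ⟨s', hs'⟩ := exists_continuous_forall_mem_convex_of_local_const
    (t := fun x => ball (s x) η ∩ thickening (η / 8) (convexHull ℝ (T x ∩ ball (s x) (2 * η))))
    (fun x => (convex_ball _ _).inter ((convex_convexHull ℝ _).thickening _)) (by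
      intro x
      obtain ⟨p, hp, hps⟩ := happ x
      refine ⟨p, ?_⟩
      have h1 : ∀ᶠ y in 𝓝 x, dist p (s y) < η :=
        (continuous_const.dist s.continuous).continuousAt.eventually_lt_const hps
      filter_upwards [h1, hlsc x p hp (η / 8) (by positivity)] with y hy ⟨q, hq, hqp⟩
      refine ⟨hy, mem_thickening_iff.2 ⟨q, subset_convexHull ℝ _ ⟨hq, ?_⟩, ?_⟩⟩
      · rw [mem_ball]
        linarith [dist_triangle q p (s y)]
      · rwa [dist_comm])
  refine ⟨s', fun x => ⟨(hs' x).1, ?_⟩⟩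
  -- Almost convexity at scale `2 * η` costs `2 * η / 16 = η / 8`; with the thickening by `η / 8`
  -- the new error is below `η / 4`.
  obtain ⟨q, hq, hqs⟩ := mem_thickening_iff.1 (hs' x).2
  obtain ⟨p, hp, hpq⟩ := mem_thickening_iff.1
    (hconv x (s x) (hs x) (2 * η) (by positivity) hηr hq)
  refine ⟨p, hp, ?_⟩
  have := dist_triangle p q (s' x)
  rw [dist_comm p q, dist_comm q (s' x)] at this
  linarith

/-- A lower semicontinuous family of closed sets in a Banach space, which are almost convex at all
small scales, has a continuous selection. -/
theorem exists_selection_of_almost_convex [CompleteSpace E] {T : X → Set E} {a : E} {r : ℝ}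
    (hr : 0 < r) (hne : ∀ x, ∃ p ∈ T x, dist p a < r / 4)
    (hlsc : ∀ x, ∀ p ∈ T x, ∀ ε > 0, ∀ᶠ y in 𝓝 x, ∃ q ∈ T y, dist q p < ε)
    (hclosed : ∀ x, closure (T x) ∩ ball a r ⊆ T x)
    (hconv : ∀ x, ∀ z ∈ ball a r, ∀ η, 0 < η → η < r →
      convexHull ℝ (T x ∩ ball z η) ⊆ thickening (η / 16) (T x)) :
    ∃ s : C(X, E), ∀ x, s x ∈ T x ∧ s x ∈ ball a r := by
  have hη : ∀ n : ℕ, 0 < r / 4 / 2 ^ n := fun n => by positivity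
  have hηr : ∀ n : ℕ, 2 * (r / 4 / 2 ^ n) < r := fun n => by
    have : r / 4 / 2 ^ n ≤ r / 4 := div_le_self (by positivity) (one_le_pow₀ (by norm_num))
    linarith
  -- The hypothesis sits under the existential, so that `choose` yields a total map `next`, which
  -- can be iterated.
  have step : ∀ (n : ℕ) (s : C(X, E)), ∃ s' : C(X, E),
      ((∀ x, s x ∈ ball a r) ∧ ∀ x, ∃ p ∈ T x, dist p (s x) < r / 4 / 2 ^ n) →
      ∀ x, dist (s' x) (s x) < r / 4 / 2 ^ n ∧
        ∃ p ∈ T x, dist p (s' x) < r / 4 / 2 ^ n / 2 := by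
    intro n s
    by_cases h : (∀ x, s x ∈ ball a r) ∧ ∀ x, ∃ p ∈ T x, dist p (s x) < r / 4 / 2 ^ n
    · obtain ⟨s', hs'⟩ :=
        exists_better_approximate_selection hlsc hconv (hη n) (hηr n) s h.1 h.2
      exact ⟨s', fun _ => hs'⟩
    · exact ⟨s, fun h' => absurd h' h⟩
  choose next hnext using step
  let s : ℕ → C(X, E) := fun n => Nat.rec (ContinuousMap.const X a) next n
  -- The moves `r / 4 / 2 ^ n` sum to `r / 2`, so the iterates never leave the ball where almost
  -- convexity is available.
  have hinv : ∀ n, (∀ x, dist (s n x) a ≤ r / 2 - r / 2 / 2 ^ n) ∧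
      ∀ x, ∃ p ∈ T x, dist p (s n x) < r / 4 / 2 ^ n := by
    intro n
    induction n with
    | zero => exact ⟨fun x => by simp [s], fun x => by simpa [s] using hne x⟩
    | succ n ih =>
      have hb : ∀ x, s n x ∈ ball a r := fun x => by
        rw [mem_ball]
        have : 0 < r / 2 / 2 ^ n := by positivity
        linarith [ih.1 x]
      have h := hnext n (s n) ⟨hb, ih.2⟩
      change ∀ x, dist (s (n + 1) x) (s n x) < r / 4 / 2 ^ n ∧
        ∃ p ∈ T x, dist p (s (n + 1) x) < r / 4 / 2 ^ n / 2 at h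
      refine ⟨fun x => ?_, fun x => ?_⟩
      · have h1 := dist_triangle (s (n + 1) x) (s n x) a
        have h2 : r / 2 / 2 ^ (n + 1) = r / 4 / 2 ^ n := by
          rw [pow_succ]; field_simp; norm_num
        have h3 : r / 2 / 2 ^ n = 2 * (r / 4 / 2 ^ n) := by field_simp; norm_num
        linarith [ih.1 x, (h x).1]
      · obtain ⟨p, hp, hps⟩ := (h x).2
        exact ⟨p, hp, by rwa [pow_succ, ← div_div]⟩
  have hb : ∀ n x, s n x ∈ ball a r := fun n x => by
    rw [mem_ball]
    have : 0 < r / 2 / 2 ^ n := by positivity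
    linarith [(hinv n).1 x]
  have hstep : ∀ x n, dist (s n x) (s (n + 1) x) ≤ r / 2 / 2 / 2 ^ n := fun x n => by
    have h := (hnext n (s n) ⟨hb n, (hinv n).2⟩ x).1
    rw [dist_comm]
    exact h.le.trans_eq (by ring)
  have hlim : ∀ x, ∃ l, Tendsto (fun n => s n x) atTop (𝓝 l) := fun x =>
    cauchySeq_tendsto_of_complete (cauchySeq_of_le_geometric_two (hstep x))
  choose l hl using hlim
  have hpow : Tendsto (fun n : ℕ => r / 2 / 2 ^ n) atTop (𝓝 0) :=
    tendsto_const_nhds.div_atTop (tendsto_pow_atTop_atTop_of_one_lt (by norm_num))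
  have hunif : TendstoUniformly (fun n x => s n x) l atTop := by
    rw [Metric.tendstoUniformly_iff]
    intro ε hε
    filter_upwards [hpow.eventually_lt_const hε] with n hn x
    rw [dist_comm]
    exact (dist_le_of_le_geometric_two_of_tendsto (hstep x) (hl x) n).trans_lt hn
  refine ⟨⟨l, hunif.continuous (Frequently.of_forall fun n => (s n).continuous)⟩, fun x => ?_⟩
  have hlb : l x ∈ ball a r := by
    have h := dist_le_of_le_geometric_two_of_tendsto₀ (hstep x) (hl x)
    rw [mem_ball, dist_comm]
    change dist a (l x) ≤ r / 2 at h
    linarith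
  refine ⟨hclosed x ⟨Metric.mem_closure_iff.2 fun ε hε => ?_, hlb⟩, hlb⟩
  obtain ⟨n, hn⟩ := (hpow.eventually_lt_const (half_pos hε)).exists
  obtain ⟨p, hp, hps⟩ := (hinv n).2 x
  refine ⟨p, hp, ?_⟩
  have h1 := dist_le_of_le_geometric_two_of_tendsto (hstep x) (hl x) n
  have h2 := dist_triangle_left (l x) p (s n x)
  rw [dist_comm (s n x) p] at h2
  have h3 : r / 4 / 2 ^ n ≤ r / 2 / 2 ^ n := by gcongr; norm_num
  change dist (l x) p < ε
  linarith

end Selection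

/-! ### Quotients of first countable groups -/

section Quotient

open Filter

variable {G : Type*} [TopologicalSpace G] [Group G] [IsTopologicalGroup G]

/-- The coset space `G/H` of a first countable topological group is pseudometrizable. -/
theorem pseudoMetrizableSpace_quotient [(𝓝 (1 : G)).IsCountablyGenerated] (H : Subgroup G) :
    TopologicalSpace.PseudoMetrizableSpace (G ⧸ H) := by
  -- Every orbit map `g ↦ g • x` is open at `1`; hence the uniformity below, with entourages `{(x, g
  -- • x) | g ∈ V}`, induces the quotient topology. It is countably generated because `𝓝 1` is.
  have hsurj : ∀ (x : G ⧸ H), map (fun g : G => g • x) (𝓝 1) = 𝓝 x := by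
    intro x
    obtain ⟨a, rfl⟩ := QuotientGroup.mk_surjective x
    have h1 : (fun g : G => g • (a : G ⧸ H)) = (QuotientGroup.mk : G → G ⧸ H) ∘ (· * a) := rfl
    rw [h1, ← map_map, map_mul_right_nhds_one]
    exact (QuotientGroup.isOpenMap_coe).map_nhds_eq QuotientGroup.continuous_mk.continuousAt
  let φ : G × (G ⧸ H) → (G ⧸ H) × (G ⧸ H) := fun z => (z.2, z.1 • z.2)
  let 𝒰 : Filter ((G ⧸ H) × (G ⧸ H)) := map φ (𝓝 1 ×ˢ ⊤)
  have hbasis : ∀ {s}, s ∈ 𝒰 ↔ ∃ V ∈ 𝓝 (1 : G), ∀ x : G ⧸ H, ∀ g ∈ V, (x, g • x) ∈ s := by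
    intro s
    rw [mem_map, mem_prod_top]
    exact ⟨fun h => ⟨_, h, fun x g hg => hg x⟩,
      fun ⟨V, hV, h⟩ => mem_of_superset hV fun g hg x => h x g hg⟩
  let us : UniformSpace (G ⧸ H) :=
    { uniformity := 𝒰
      symm := by
        intro s hs
        obtain ⟨V, hV, h⟩ := hbasis.1 hs
        refine hbasis.2 ⟨V⁻¹, inv_mem_nhds_one G hV, fun x g hg => ?_⟩
        simpa using h (g • x) g⁻¹ hg
      comp := by
        intro s hs
        obtain ⟨V, hV, h⟩ := hbasis.1 hs
        obtain ⟨W, hW, hWV⟩ := exists_nhds_one_split hV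
        refine (mem_lift'_sets (by exact monotone_id.relComp monotone_id)).2
          ⟨{p | ∃ g ∈ W, p.2 = g • p.1}, hbasis.2 ⟨W, hW, fun x g hg => ⟨g, hg, rfl⟩⟩, ?_⟩
        rintro ⟨x, z⟩ ⟨y, ⟨g, hg, h1⟩, g', hg', h2⟩
        simp only at h1 h2
        subst h1 h2
        have := h x (g' * g) (hWV g' hg' g hg)
        rwa [mul_smul] at this
      nhds_eq_comap_uniformity := by
        intro x
        ext s
        rw [← hsurj x, mem_map, mem_comap_prodMk, hbasis]
        constructor
        · refine fun hs => ⟨_, hs, fun y g hg hy => ?_⟩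
          obtain rfl : y = x := hy
          exact hg
        · rintro ⟨V, hV, h⟩
          exact mem_of_superset hV fun g hg => h x g hg rfl }
  have : (uniformity (G ⧸ H)).IsCountablyGenerated := by
    change (map φ (𝓝 1 ×ˢ ⊤)).IsCountablyGenerated
    infer_instance
  exact UniformSpace.pseudoMetrizableSpace

end Quotient

/-! ### Local sections of `G → G/H` -/

/-- The canonical projection `G → G/H` has a continuous section near each point. -/
def HasLocalSections {G : Type*} [TopologicalSpace G] [Group G] (H : Subgroup G) : Prop :=
  ∀ c : G ⧸ H, ∃ V ∈ 𝓝 c, ∃ σ : G ⧸ H → G, ContinuousOn σ V ∧ ∀ v ∈ V, (σ v : G ⧸ H) = v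

section LocalSections

open Filter Metric

theorem HasLocalSections.of_one {G : Type*} [TopologicalSpace G] [Group G] [IsTopologicalGroup G]
    {H : Subgroup G}
    (h : ∃ V ∈ 𝓝 ((1 : G) : G ⧸ H), ∃ σ : G ⧸ H → G, ContinuousOn σ V ∧
      ∀ v ∈ V, (σ v : G ⧸ H) = v) : HasLocalSections H := by
  intro c
  obtain ⟨g, rfl⟩ := QuotientGroup.mk_surjective c
  obtain ⟨V, hV, σ, hσ, hs⟩ := h
  have hcont : Continuous fun c : G ⧸ H => g⁻¹ • c := continuous_const_smul g⁻¹
  refine ⟨(fun c : G ⧸ H => g⁻¹ • c) ⁻¹' V, hcont.continuousAt.preimage_mem_nhds ?_,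
    fun c => g * σ (g⁻¹ • c), ?_, ?_⟩
  · simpa [MulAction.Quotient.smul_coe] using hV
  · exact continuousOn_const.mul (hσ.comp hcont.continuousOn fun _ h => h)
  · intro c hc
    change g • (σ (g⁻¹ • c) : G ⧸ H) = c
    rw [hs _ hc, smul_inv_smul]

/-- A continuous map to `G/H` lifts locally to `G`. -/
theorem HasLocalSections.exists_lift {G : Type*} [TopologicalSpace G] [Group G]
    {H : Subgroup G} (hH : HasLocalSections H) {Y : Type*} [TopologicalSpace Y]
    {u : Y → G ⧸ H} {U : Set Y} (hU : IsOpen U) (hu : ContinuousOn u U) {y : Y} (hy : y ∈ U) :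
    ∃ W ⊆ U, IsOpen W ∧ y ∈ W ∧ ∃ τ : Y → G, ContinuousOn τ W ∧
      ∀ z ∈ W, (τ z : G ⧸ H) = u z := by
  obtain ⟨V, hV, σ, hσ, hs⟩ := hH (u y)
  obtain ⟨V', hV', hopen, hyV⟩ := mem_nhds_iff.1 hV
  exact ⟨U ∩ u ⁻¹' V', Set.inter_subset_left, hu.isOpen_inter_preimage hU hopen, ⟨hy, hyV⟩,
    σ ∘ u, hσ.comp (hu.mono Set.inter_subset_left) fun z hz => hV' hz.2,
    fun z hz => hs _ (hV' hz.2)⟩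

variable {E F : Type*} [NormedAddCommGroup E] [NormedSpace ℝ E] [NormedAddCommGroup F]
  [NormedSpace ℝ F]

/-- If `f (p, b) = p` and the partial derivative of `f` in the second variable at `(a, b)` is
bounded below, then sets which near `a` are the images of balls around `b` under the maps
`f (p, ·)`, for each of their points `p`, are almost convex at small scales. -/
theorem exists_convexHull_subset_thickening {X : Type*} {T : X → Set E} {f : E × F → E}
    {A : E × F →L[ℝ] E} {a : E} {b : F} (hf : HasStrictFDerivAt f A (a, b))
    (hfb : ∀ᶠ p in 𝓝 a, f (p, b) = p) {K : NNReal}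
    (hA : AntilipschitzWith K fun y : F => A (0, y))
    (hT : ∀ᶠ z : E × F in 𝓝 (a, b), ∀ x, z.1 ∈ T x → f z ∈ T x)
    (hT' : ∀ V ∈ 𝓝 b, ∀ᶠ z : E × E in 𝓝 (a, a), ∀ x, z.1 ∈ T x → z.2 ∈ T x →
      ∃ y ∈ V, f (z.1, y) = z.2) :
    ∀ᶠ r in 𝓝[>] (0 : ℝ), ∀ x, ∀ z ∈ ball a r, ∀ η, 0 < η → η < r →
      convexHull ℝ (T x ∩ ball z η) ⊆ thickening (η / 16) (T x) := by
  -- Adding `1` makes the constant positive. The choice `C * ε = 1 / 256` makes the linearization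
  -- error `η / 64` on balls of radius `4 * C * η`.
  set C : ℝ := K + 1 with hC
  have hC0 : 0 < C := by positivity
  have hAC : ∀ y : F, ‖y‖ ≤ C * ‖A (0, y)‖ := fun y => by
    have h := hA.le_mul_dist y 0
    have h0 : A (0, (0 : F)) = 0 := map_zero A
    rw [dist_zero_right, h0, dist_zero_right] at h
    nlinarith [norm_nonneg (A (0, y))]
  set ε : ℝ := 1 / (256 * C) with hε
  have hε0 : 0 < ε := by positivity
  have hCε : C * ε = 1 / 256 := by rw [hε]; field_simp
  -- Strict differentiability is applied to the pair `(p, y)`, `(p, b)`: since `f (p, b) = p`, the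
  -- estimate is uniform in the base point `p`.
  have hest : ∀ᶠ z : E × F in 𝓝 (a, b), ‖f z - z.1 - A (0, z.2 - b)‖ ≤ ε * ‖z.2 - b‖ := by
    have h1 := hf.isLittleO.def hε0
    have h2 : Tendsto (fun z : E × F => (z, (z.1, b))) (𝓝 (a, b)) (𝓝 ((a, b), (a, b))) := by
      apply Continuous.tendsto' (by fun_prop)
      rfl
    filter_upwards [h2.eventually h1, (continuous_fst.tendsto (a, b)).eventually hfb] with z hz hz'
    have h3 : z - (z.1, b) = (0, z.2 - b) := by ext <;> simp
    simp only [hz', h3] at hz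
    simpa [Prod.norm_def] using hz
  obtain ⟨δ, hδ, hgood⟩ := Metric.eventually_nhds_iff_ball.1 (hest.and hT)
  obtain ⟨δ', hδ', hgood'⟩ := Metric.eventually_nhds_iff_ball.1 (hT' _ (ball_mem_nhds b hδ))
  simp only [← ball_prod_same, Set.mem_prod, and_imp, Prod.forall] at hgood hgood'
  have hev : ∀ᶠ r in 𝓝[>] (0 : ℝ), 0 < r ∧ 2 * r < δ ∧ 2 * r < δ' ∧ 4 * C * r < δ := by
    have aux : ∀ c : ℝ, ∀ d > 0, ∀ᶠ r in 𝓝[>] (0 : ℝ), c * r < d := fun c d hd => by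
      have : Tendsto (fun r : ℝ => c * r) (𝓝[>] 0) (𝓝 0) :=
        ((continuous_const_mul c).tendsto' 0 0 (mul_zero c)).mono_left nhdsWithin_le_nhds
      exact this.eventually_lt_const hd
    filter_upwards [self_mem_nhdsWithin, aux 2 δ hδ, aux 2 δ' hδ', aux (4 * C) δ hδ] with
      r h1 h2 h3 h4 using ⟨h1, h2, h3, h4⟩
  filter_upwards [hev] with r ⟨hr, h2, h3, h4⟩ x z hz η hη hηr q hq
  have hball : ∀ p ∈ ball z η, dist p a < 2 * r := fun p hp => by
    have h5 := dist_triangle p z a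
    rw [mem_ball] at hp hz
    linarith
  obtain ⟨p₀, hp₀, hp₀z⟩ : (T x ∩ ball z η).Nonempty :=
    convexHull_nonempty_iff.1 ⟨q, hq⟩
  have hp₀a := hball p₀ hp₀z
  let L : F →ₗ[ℝ] E := A.toLinearMap ∘ₗ LinearMap.inr ℝ E F
  have hL : ∀ y, L y = A (0, y) := fun y => rfl
  -- Any `p` here is `f (p₀, y)` with `‖p - p₀‖ < 2 * η`. The lower bound on `A` then forces `‖y -
  -- b‖ ≤ 4 * C * η`, so `p` is within `η / 64` of the affine image of a ball.
  have hsub : T x ∩ ball z η ⊆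
      cthickening (η / 64) ((fun y => p₀ + L y) '' closedBall (0 : F) (4 * C * η)) := by
    rintro p ⟨hp, hpz⟩
    obtain ⟨y, hy, hyp⟩ := hgood' p₀ p (hp₀a.trans h3) ((hball p hpz).trans h3) x hp₀ hp
    have h5 := (hgood p₀ y (hp₀a.trans h2) hy).1
    rw [hyp] at h5
    have h6 : ‖p - p₀‖ < 2 * η := by
      rw [← dist_eq_norm]
      have := dist_triangle_right p p₀ z
      rw [mem_ball] at hpz hp₀z
      linarith
    have h7 : ‖A (0, y - b)‖ ≤ ‖p - p₀‖ + ε * ‖y - b‖ := by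
      have := norm_sub_le (p - p₀) (p - p₀ - A (0, y - b))
      rw [sub_sub_cancel] at this
      linarith
    have h8 : ‖y - b‖ ≤ 4 * C * η := by
      have h9 := (hAC (y - b)).trans (mul_le_mul_of_nonneg_left h7 hC0.le)
      rw [mul_add, ← mul_assoc, hCε] at h9
      nlinarith [norm_nonneg (y - b)]
    refine mem_cthickening_of_dist_le p _ _ _ ⟨y - b, by simpa using h8, rfl⟩ ?_
    simp only [dist_eq_norm, hL, ← sub_sub]
    refine h5.trans ((mul_le_mul_of_nonneg_left h8 hε0.le).trans_eq ?_)
    rw [show ε * (4 * C * η) = 4 * (C * ε) * η by ring, hCε]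
    ring
  have hconvex : Convex ℝ
      (cthickening (η / 64) ((fun y => p₀ + L y) '' closedBall (0 : F) (4 * C * η))) := by
    apply Convex.cthickening
    have := ((convex_closedBall (0 : F) (4 * C * η)).linear_image L).translate p₀
    rwa [Set.image_image] at this
  have hq' := convexHull_min hsub hconvex hq
  obtain ⟨_, ⟨y, hy, rfl⟩, hqy⟩ := mem_thickening_iff.1
    (cthickening_subset_thickening' (by positivity : 0 < η / 32) (by linarith) _ hq')
  rw [mem_closedBall_zero_iff] at hy
  have hyb : dist (y + b) b < δ := by
    rw [dist_eq_norm, add_sub_cancel_right]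
    refine hy.trans_lt (lt_of_le_of_lt ?_ h4)
    gcongr
  obtain ⟨h5, h6⟩ := hgood p₀ (y + b) (hp₀a.trans h2) hyb
  -- Returning from the affine image to `T x` costs another `η / 64`; in total `η / 32 + η / 64 < η
  -- / 16`.
  refine mem_thickening_iff.2 ⟨_, h6 x hp₀, ?_⟩
  simp only [add_sub_cancel_right] at h5
  have h7 : dist (p₀ + L y) (f (p₀, y + b)) ≤ η / 64 := by
    rw [dist_comm, dist_eq_norm, hL, ← sub_sub]
    refine h5.trans ((mul_le_mul_of_nonneg_left hy hε0.le).trans_eq ?_)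
    rw [show ε * (4 * C * η) = 4 * (C * ε) * η by ring, hCε]
    ring
  linarith [dist_triangle q (p₀ + L y) (f (p₀, y + b))]

end LocalSections

/-! ### Multiplication in charts, and local sections for closed Banach Lie subgroups -/

section BanachLie

open Filter Metric

variable {E : Type*} [NormedAddCommGroup E]
  {G : Type*} [TopologicalSpace G] [ChartedSpace E G] [Group G]
  {F : Type*} [NormedAddCommGroup F]
  (H : Subgroup G) [ChartedSpace F H]

/-- The multiplication `G × H → G` in the charts at `1`. -/
noncomputable def chartMul (z : E × F) : E :=
  chartAt E (1 : G) ((chartAt E (1 : G)).symm z.1 * ((chartAt F (1 : H)).symm z.2 : G))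

theorem chartMul_apply_base {p : E} (hp : p ∈ (chartAt E (1 : G)).target) :
    chartMul H (p, chartAt F (1 : H) 1) = p := by
  simp [chartMul, hp]

section Lie

variable [NormedSpace ℝ E] [NormedSpace ℝ F] [LieGroup 𝓘(ℝ, E) ∞ G]

theorem contDiffAt_chartMul (hH : IsClosedBanachLieSubgroup (E := E) (F := F) H) :
    ContDiffAt ℝ ∞ (chartMul (E := E) (F := F) H) (chartAt E (1 : G) 1, chartAt F (1 : H) 1) := by
  have h1 : ContMDiff (𝓘(ℝ, E).prod 𝓘(ℝ, F)) 𝓘(ℝ, E) ∞ fun z : G × H => z.1 * (z.2 : G) :=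
    contMDiff_fst.mul (hH.contMDiff_inclusion.comp contMDiff_snd)
  have h2 := (contMDiffAt_iff.1 (h1.contMDiffAt (x := ((1 : G), (1 : H))))).2
  rw [ModelWithCorners.range_eq_univ, contDiffWithinAt_univ] at h2
  simp only [OneMemClass.coe_one, mul_one] at h2
  exact h2

/-- Since `1 * h = h`, the partial derivative in the direction of `H` is the differential of the
inclusion at `1`. An injective operator with closed range between Banach spaces is bounded below. -/
theorem exists_antilipschitz_fderiv_chartMul [CompleteSpace E] [CompleteSpace F]
    (hH : IsClosedBanachLieSubgroup (E := E) (F := F) H) :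
    ∃ K : NNReal, AntilipschitzWith K fun y : F => fderiv ℝ (chartMul (E := E) (F := F) H)
      (chartAt E (1 : G) 1, chartAt F (1 : H) 1) (0, y) := by
  let D : F →L[ℝ] E := mfderiv 𝓘(ℝ, F) 𝓘(ℝ, E) (Subtype.val : H → G) 1
  obtain ⟨K, hK⟩ := D.antilipschitz_of_injective_of_isClosed_range
    hH.injective_differential hH.isClosed_range_differential
  refine ⟨K, ?_⟩
  have h1 : MDifferentiableAt 𝓘(ℝ, F) 𝓘(ℝ, E) (Subtype.val : H → G) 1 :=
    hH.contMDiff_inclusion.mdifferentiable (by simp) 1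
  have h2 : HasFDerivAt (fun y : F => chartMul (E := E) (F := F) H (chartAt E (1 : G) 1, y)) _
      (chartAt F (1 : H) 1) :=
    (((contDiffAt_chartMul H hH).differentiableAt (by simp)).hasFDerivAt).comp _
      (hasFDerivAt_prodMk_right _ _)
  have h3 : D =
      fderiv ℝ (fun y : F => chartMul (E := E) (F := F) H (chartAt E (1 : G) 1, y))
        (chartAt F (1 : H) 1) := by
    have h4 := h1.mfderiv
    rw [ModelWithCorners.range_eq_univ, fderivWithin_univ] at h4
    refine h4.trans ?_
    congr 1
    ext y
    simp [chartMul, writtenInExtChartAt, mfld_simps]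
  rw [h3, h2.fderiv] at hK
  exact hK

end Lie

/-- The fibre of `G → G/H` over `c`, in the chart of `G` at `1`. -/
def chartFibre (E : Type*) [NormedAddCommGroup E] {G : Type*} [TopologicalSpace G]
    [ChartedSpace E G] [Group G] (H : Subgroup G) (c : G ⧸ H) : Set E :=
  {p ∈ (chartAt E (1 : G)).target | ((chartAt E (1 : G)).symm p : G ⧸ H) = c}

variable [IsTopologicalGroup G]

/-- Right multiplication by `H` preserves cosets; closeness to the base point is needed only for the
product to stay in the chart domain. -/
theorem eventually_chartMul_mem_chartFibre :
    ∀ᶠ z : E × F in 𝓝 (chartAt E (1 : G) 1, chartAt F (1 : H) 1), ∀ c,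
      z.1 ∈ chartFibre E H c → chartMul H z ∈ chartFibre E H c := by
  set φ := chartAt E (1 : G)
  set ψ := chartAt F (1 : H)
  have h1 : ContinuousAt φ.symm (φ 1) := φ.continuousAt_symm (by simp [φ])
  have h2 : ContinuousAt ψ.symm (ψ 1) := ψ.continuousAt_symm (by simp [ψ])
  have h3 : ContinuousAt (fun z : E × F => φ.symm z.1 * (ψ.symm z.2 : G)) (φ 1, ψ 1) :=
    (h1.comp (f := Prod.fst) continuousAt_fst).mul
      (continuous_subtype_val.continuousAt.comp (h2.comp (f := Prod.snd) continuousAt_snd))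
  have h4 : ∀ᶠ z : E × F in 𝓝 (φ 1, ψ 1), φ.symm z.1 * (ψ.symm z.2 : G) ∈ φ.source := by
    refine h3.eventually (φ.open_source.mem_nhds ?_)
    simp [φ, ψ]
  filter_upwards [h4] with z hz c hc
  refine ⟨φ.map_source hz, ?_⟩
  change ((φ.symm (φ (φ.symm z.1 * (ψ.symm z.2 : G))) : G) : G ⧸ H) = c
  rw [φ.left_inv hz, QuotientGroup.mk_mul_of_mem _ (ψ.symm z.2).2]
  exact hc.2

/-- Two points of one coset differ by an element of `H` that is close to `1` in `G`. As `H` carries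
the subspace topology, it is close to `1` in `H` as well, so its coordinate lies in `V`. -/
theorem eventually_exists_chartMul_eq {V : Set F} (hV : V ∈ 𝓝 (chartAt F (1 : H) 1)) :
    ∀ᶠ z : E × E in 𝓝 (chartAt E (1 : G) 1, chartAt E (1 : G) 1), ∀ c,
      z.1 ∈ chartFibre E H c → z.2 ∈ chartFibre E H c → ∃ y ∈ V, chartMul H (z.1, y) = z.2 := by
  set φ := chartAt E (1 : G)
  set ψ := chartAt F (1 : H)
  have h1 : ContinuousAt φ.symm (φ 1) := φ.continuousAt_symm (by simp [φ])
  have h2 : ψ.source ∩ ψ ⁻¹' V ∈ 𝓝 (1 : H) :=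
    inter_mem (ψ.open_source.mem_nhds (by simp [ψ]))
      ((ψ.continuousAt (by simp [ψ])).preimage_mem_nhds hV)
  obtain ⟨N, hN, hNV⟩ := mem_nhds_subtype _ _ _ |>.1 h2
  have h3 : ContinuousAt (fun z : E × E => (φ.symm z.1)⁻¹ * φ.symm z.2) (φ 1, φ 1) :=
    (h1.comp (f := Prod.fst) continuousAt_fst).inv.mul (h1.comp (f := Prod.snd) continuousAt_snd)
  have h4 : ∀ᶠ z : E × E in 𝓝 (φ 1, φ 1), (φ.symm z.1)⁻¹ * φ.symm z.2 ∈ N := by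
    refine h3.eventually ?_
    simpa [φ] using hN
  filter_upwards [h4] with z hz c hc hc'
  have hmem : (φ.symm z.1)⁻¹ * φ.symm z.2 ∈ H := QuotientGroup.eq.1 (hc.2.trans hc'.2.symm)
  obtain ⟨h5, h6⟩ := @hNV ⟨_, hmem⟩ hz
  refine ⟨ψ ⟨_, hmem⟩, h6, ?_⟩
  change φ (φ.symm z.1 * (ψ.symm (ψ ⟨_, hmem⟩) : G)) = z.2
  rw [ψ.left_inv h5, mul_inv_cancel_left, φ.right_inv hc'.1]

variable [NormedSpace ℝ E] [NormedSpace ℝ F]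

theorem hasLocalSections_of_isClosedBanachLieSubgroup [CompleteSpace E] [CompleteSpace F]
    [LieGroup 𝓘(ℝ, E) ∞ G] (hH : IsClosedBanachLieSubgroup (E := E) (F := F) H) :
    HasLocalSections H := by
  apply HasLocalSections.of_one
  let φ := chartAt E (1 : G)
  let a := φ 1
  let π : E → G ⧸ H := fun p => (φ.symm p : G ⧸ H)
  have hφ1 : (1 : G) ∈ φ.source := mem_chart_source E 1
  have ha : a ∈ φ.target := φ.map_source hφ1
  have hπ : ∀ p ∈ φ.target, map π (𝓝 p) = 𝓝 (π p) := fun p hp => by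
    change map ((QuotientGroup.mk : G → G ⧸ H) ∘ φ.symm) (𝓝 p) = _
    rw [← map_map, φ.symm.map_nhds_eq hp]
    exact QuotientGroup.isOpenMap_coe.map_nhds_eq QuotientGroup.continuous_mk.continuousAt
  have : (𝓝 (1 : G)).IsCountablyGenerated := by
    have h := φ.symm.map_nhds_eq ha
    rw [φ.left_inv hφ1] at h
    rw [← h]
    infer_instance
  have := pseudoMetrizableSpace_quotient H
  obtain ⟨K, hK⟩ := exists_antilipschitz_fderiv_chartMul (E := E) H hH
  have hconv := exists_convexHull_subset_thickening (T := chartFibre E H)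
    ((contDiffAt_chartMul H hH).hasStrictFDerivAt (by simp))
    (by filter_upwards [φ.open_target.mem_nhds ha] with p hp using chartMul_apply_base H hp)
    hK (eventually_chartMul_mem_chartFibre H) (fun V hV => eventually_exists_chartMul_eq H hV)
  have hsmall : ∀ᶠ r in 𝓝[>] (0 : ℝ), ball a r ⊆ φ.target := by
    obtain ⟨ρ, hρ, h⟩ := Metric.mem_nhds_iff.1 (φ.open_target.mem_nhds ha)
    filter_upwards [nhdsWithin_le_nhds (Iio_mem_nhds hρ)] with r hr
      using (ball_subset_ball (le_of_lt hr)).trans h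
  obtain ⟨r, ⟨hr : 0 < r, hconv⟩, hsmall⟩ :=
    ((eventually_mem_nhdsWithin.and hconv).and hsmall).exists
  have hV : π '' ball a (r / 4) ∈ 𝓝 ((1 : G) : G ⧸ H) := by
    have h1 : π a = ((1 : G) : G ⧸ H) := congrArg _ (φ.left_inv hφ1)
    rw [← h1, ← hπ a ha]
    exact image_mem_map (ball_mem_nhds a (by positivity))
  let V := π '' ball a (r / 4)
  -- A pseudometric on `V` supplies the normality and paracompactness needed for the selection
  -- theorem.
  let _ := TopologicalSpace.pseudoMetrizableSpacePseudoMetric V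
  have hclosed : IsClosed (H : Set G) := hH.isClosed
  have : T1Space (G ⧸ H) := inferInstance
  have hne : ∀ x : V, ∃ p ∈ chartFibre E H x, dist p a < r / 4 := by
    rintro ⟨_, p, hp, rfl⟩
    exact ⟨p, ⟨hsmall (ball_subset_ball (by linarith) hp), rfl⟩, hp⟩
  -- Lower semicontinuity of the fibres is openness of `π`; their relative closedness, below, comes
  -- from `G/H` being T1.
  have hlsc : ∀ x : V, ∀ p ∈ chartFibre E H x, ∀ ε > 0, ∀ᶠ y : V in 𝓝 x,
      ∃ q ∈ chartFibre E H y, dist q p < ε := by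
    rintro ⟨x, hx⟩ p ⟨hp, rfl⟩ ε hε
    have h1 : π '' (ball p ε ∩ φ.target) ∈ 𝓝 (π p) := by
      rw [← hπ p hp]
      exact image_mem_map (inter_mem (ball_mem_nhds p hε) (φ.open_target.mem_nhds hp))
    filter_upwards [continuous_subtype_val.continuousAt.preimage_mem_nhds h1] with y hy
    obtain ⟨q, ⟨hq, hq'⟩, hqy⟩ := hy
    exact ⟨q, ⟨hq', hqy⟩, hq⟩
  have hcl : ∀ x : V, closure (chartFibre E H x) ∩ ball a r ⊆ chartFibre E H x := by
    rintro ⟨x, hx⟩ p ⟨hp, hpa⟩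
    refine ⟨hsmall hpa, ?_⟩
    by_contra hne
    have h1 : ContinuousAt π p := (hπ p (hsmall hpa)).le
    have h2 := h1.eventually (isOpen_compl_singleton.mem_nhds hne)
    obtain ⟨q, hq, hq'⟩ := (mem_closure_iff_frequently.1 hp).and_eventually h2 |>.exists
    exact hq' hq.2
  obtain ⟨s, hs⟩ := exists_selection_of_almost_convex hr hne hlsc hcl fun x => hconv x
  classical
  refine ⟨V, hV, fun c => if h : c ∈ V then φ.symm (s ⟨c, h⟩) else 1, ?_, ?_⟩
  · rw [continuousOn_iff_continuous_domRestrict]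
    have h1 : Continuous fun x : V => φ.symm (s x) :=
      φ.continuousOn_symm.comp_continuous s.continuous fun x => (hs x).1.1
    convert h1 using 2 with x
    simp
  · intro c hc
    simp only [hc, dif_pos]
    exact (hs ⟨c, hc⟩).1.2

end BanachLie

/-! ### Sections of `P/H → M` and reductions of the structure group -/

namespace PrincipalBundle

open Filter

section OrbitSpace

variable {M : Type u} [TopologicalSpace M] {G : Type v} [TopologicalSpace G] [Group G]
  (P : PrincipalBundle.{u, v, w} M G) (H : Subgroup G)

instance continuousConstSMul : ContinuousConstSMul Gᵐᵒᵖ P.Total where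
  continuous_const_smul g :=
    P.continuous_act.comp (by fun_prop : Continuous fun x : P.Total => (x, g.unop))

theorem map_proj_nhds (p : P.Total) : map P.proj (𝓝 p) = 𝓝 (P.proj p) := by
  obtain ⟨e, he, -⟩ := P.locally_trivial (P.proj p)
  exact e.map_proj_nhds (e.mem_source.2 he)

/-- The orbit of `p` under `H`. -/
def orbitMk (p : P.Total) : P.OrbitSpace H := Quotient.mk _ p

variable {P H}

theorem continuous_orbitMk : Continuous (P.orbitMk H) := continuous_quot_mk

theorem isOpenMap_orbitMk : IsOpenMap (P.orbitMk H) :=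
  have : ContinuousConstSMul H.op P.Total := ⟨fun c => continuous_const_smul (c : Gᵐᵒᵖ)⟩
  isOpenMap_quotient_mk'_mul

theorem orbitMk_surjective : Function.Surjective (P.orbitMk H) := Quotient.mk_surjective

theorem orbitMk_eq_iff {p q : P.Total} :
    P.orbitMk H p = P.orbitMk H q ↔ ∃ h : H, MulOpposite.op (h : G) • p = q := by
  rw [eq_comm]
  refine Quotient.eq.trans ?_
  rw [MulAction.orbitRel_apply, MulAction.mem_orbit_iff]
  constructor
  · rintro ⟨⟨g, hg⟩, h⟩
    exact ⟨⟨g.unop, hg⟩, h⟩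
  · rintro ⟨⟨g, hg⟩, h⟩
    exact ⟨⟨MulOpposite.op g, hg⟩, h⟩

theorem orbitProj_orbitMk (p : P.Total) : P.orbitProj H (P.orbitMk H p) = P.proj p := rfl

theorem orbitMk_act (p : P.Total) (h : H) :
    P.orbitMk H (MulOpposite.op (h : G) • p) = P.orbitMk H p :=
  (orbitMk_eq_iff.2 ⟨h, rfl⟩).symm

/-- For `q = p · g` the two coordinates differ by `g`. Freeness of the action turns `p · g = p · h`
into `g = h`, so lying in one `H`-orbit means `g ∈ H`. -/
theorem orbitMk_eq_iff_of_isEquivariant {e : Bundle.Trivialization G P.proj}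
    (he : P.IsEquivariant e) {p q : P.Total} (hp : p ∈ e.source) (hpq : P.proj p = P.proj q) :
    P.orbitMk H p = P.orbitMk H q ↔ ((e p).2 : G ⧸ H) = (e q).2 := by
  obtain ⟨g, rfl⟩ := (P.proj_eq_iff p q).1 hpq
  rw [orbitMk_eq_iff, QuotientGroup.eq, he p hp, inv_mul_cancel_left]
  constructor
  · rintro ⟨h, hh⟩
    have h1 : MulOpposite.op (g * (h : G)⁻¹) • p = p := by
      rw [MulOpposite.op_mul, mul_smul, ← hh, smul_smul, ← MulOpposite.op_mul, mul_inv_cancel,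
        MulOpposite.op_one, one_smul]
    rw [mul_inv_eq_one.1 (P.free p _ h1)]
    exact h.2
  · exact fun hg => ⟨⟨g, hg⟩, rfl⟩

/-- The coset of `s p`, where `σ (π p)` is the orbit of `p` and `e` is the trivialization
`p ↦ (π p, s p)`. -/
noncomputable def sectionCoset (σ : M → P.OrbitSpace H) (e : Bundle.Trivialization G P.proj)
    (m : M) : G ⧸ H :=
  (e (orbitMk_surjective (σ m)).choose).2

theorem sectionCoset_proj {σ : M → P.OrbitSpace H} (hσ : ∀ m, P.orbitProj H (σ m) = m)
    {e : Bundle.Trivialization G P.proj} (he : P.IsEquivariant e) {p : P.Total}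
    (hp : p ∈ e.source) (hpσ : σ (P.proj p) = P.orbitMk H p) :
    sectionCoset σ e (P.proj p) = (e p).2 := by
  have h := (orbitMk_surjective (σ (P.proj p))).choose_spec
  have h1 := hσ (P.proj p)
  rw [← h, orbitProj_orbitMk] at h1
  refine (((orbitMk_eq_iff_of_isEquivariant he) ?_ h1).1 (h.trans hpσ))
  rwa [e.mem_source, h1, ← e.mem_source]

/-- The orbit map is open, so for `m'` near `m` the orbit `σ m'` has a representative near a given
representative of `σ m`; the coset may be computed from any representative. -/
theorem continuousOn_sectionCoset {σ : M → P.OrbitSpace H} (hc : Continuous σ)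
    (hσ : ∀ m, P.orbitProj H (σ m) = m)
    {e : Bundle.Trivialization G P.proj} (he : P.IsEquivariant e) :
    ContinuousOn (sectionCoset σ e) e.baseSet := by
  intro m hm
  apply ContinuousAt.continuousWithinAt
  obtain ⟨p, hp⟩ := orbitMk_surjective (σ m)
  have h1 := hσ m
  rw [← hp, orbitProj_orbitMk] at h1
  subst h1
  have hps := e.mem_source.2 hm
  intro N hN
  rw [sectionCoset_proj hσ he hps hp.symm] at hN
  have h2 : ContinuousAt (fun q => ((e q).2 : G ⧸ H)) p :=
    QuotientGroup.continuous_mk.continuousAt.comp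
      (continuous_snd.continuousAt.comp (e.continuousAt hps))
  have h3 := (isOpenMap_orbitMk (H := H)).image_mem_nhds
    (inter_mem (h2 hN) (e.open_source.mem_nhds hps))
  rw [hp] at h3
  change ∀ᶠ m' in 𝓝 (P.proj p), sectionCoset σ e m' ∈ N
  filter_upwards [hc.continuousAt h3] with m' hm'
  obtain ⟨q, ⟨hqN, hqs⟩, hq⟩ := hm'
  have h4 := hσ m'
  rw [← hq, orbitProj_orbitMk] at h4
  subst h4
  rw [sectionCoset_proj hσ he hqs hq.symm]
  exact hqN

/-- The image in `P` of a fibre of `Q` lies in a single `H`-orbit, which is the value of the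
section. Continuity descends because `Q.proj` maps neighbourhood filters onto neighbourhood filters.
-/
theorem ReducesTo.hasGlobalSection (h : P.ReducesTo H) : P.HasGlobalSection H := by
  obtain ⟨Q, φ, hφ, hφe⟩ := h
  let σ : M → P.OrbitSpace H := fun m => P.orbitMk H (φ (Q.surjective_proj m).choose)
  have hσ : ∀ q, σ (Q.proj q) = P.orbitMk H (φ q) := by
    intro q
    obtain ⟨h, hh⟩ := (Q.proj_eq_iff _ _).1 (Q.surjective_proj (Q.proj q)).choose_spec.symm
    change P.orbitMk H (φ (Q.surjective_proj (Q.proj q)).choose) = _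
    rw [← hh, hφe, orbitMk_act]
  refine ⟨⟨σ, continuous_iff_continuousAt.2 fun m => ?_⟩, fun m => ?_⟩
  · obtain ⟨q, rfl⟩ := Q.surjective_proj m
    rw [ContinuousAt, ← Q.map_proj_nhds, tendsto_map'_iff, hσ]
    have h1 : σ ∘ Q.proj = P.orbitMk H ∘ φ := funext hσ
    rw [h1]
    exact (continuous_orbitMk.comp φ.continuous).continuousAt
  · obtain ⟨q, rfl⟩ := Q.surjective_proj m
    change P.orbitProj H (σ _) = _
    rw [hσ, orbitProj_orbitMk, hφ]

end OrbitSpace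

/-! ### The reduction cut out by a section -/

section Reduction

variable {M : Type u} [TopologicalSpace M] {G : Type v} [TopologicalSpace G] [Group G]
  {P : PrincipalBundle.{u, v, w} M G} {H : Subgroup G}

/-- The part of `P` on which the section `σ` of `P/H → M` is the orbit map. -/
abbrev ReductionTotal (σ : M → P.OrbitSpace H) : Type w :=
  {p : P.Total // σ (P.proj p) = P.orbitMk H p}

instance reductionAction (σ : M → P.OrbitSpace H) : MulAction Hᵐᵒᵖ (ReductionTotal σ) where
  smul h x := ⟨MulOpposite.op (h.unop : G) • x.1, by
    rw [P.proj_act, orbitMk_act]; exact x.2⟩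
  one_smul x := Subtype.ext (one_smul _ _)
  mul_smul a b x := Subtype.ext (mul_smul (MulOpposite.op (a.unop : G))
    (MulOpposite.op (b.unop : G)) x.1)

theorem exists_reductionTotal {σ : M → P.OrbitSpace H} (hσ : ∀ m, P.orbitProj H (σ m) = m)
    (m : M) : ∃ x : ReductionTotal σ, P.proj x.1 = m := by
  obtain ⟨p, hp⟩ := orbitMk_surjective (σ m)
  have h1 := hσ m
  rw [← hp, orbitProj_orbitMk] at h1
  subst h1
  exact ⟨⟨p, hp.symm⟩, rfl⟩

theorem inv_mul_mem_of_sectionCoset {σ : M → P.OrbitSpace H}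
    (hσ : ∀ m, P.orbitProj H (σ m) = m) {e : Bundle.Trivialization G P.proj}
    (he : P.IsEquivariant e) {g : G} (x : ReductionTotal σ) (hx : x.1 ∈ e.source)
    (hg : (g : G ⧸ H) = sectionCoset σ e (P.proj x.1)) : g⁻¹ * (e x.1).2 ∈ H := by
  rw [sectionCoset_proj hσ he hx x.2] at hg
  exact QuotientGroup.eq.1 hg

theorem eq_orbitMk_symm {σ : M → P.OrbitSpace H}
    (hσ : ∀ m, P.orbitProj H (σ m) = m) {e : Bundle.Trivialization G P.proj}
    (he : P.IsEquivariant e) {m : M} (hm : m ∈ e.baseSet) {g : G}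
    (hg : (g : G ⧸ H) = sectionCoset σ e m) :
    σ m = P.orbitMk H (e.toOpenPartialHomeomorph.symm (m, g)) := by
  obtain ⟨⟨p, hp⟩, hpm : P.proj p = m⟩ := exists_reductionTotal hσ m
  subst hpm
  have hps := e.mem_source.2 hm
  rw [sectionCoset_proj hσ he hps hp] at hg
  rw [hp, orbitMk_eq_iff_of_isEquivariant he hps (e.proj_symm_apply' hm).symm,
    e.apply_symm_apply' hm, hg]

open Classical in
/-- The local trivialization `p ↦ (π p, τ (π p)⁻¹ * s p)` of the reduction given by `σ`, where
`p ↦ (π p, s p)` is a local trivialization of `P` and `τ` is a local lift to `G` of the map to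
`G/H` corresponding to `σ`. -/
noncomputable def reductionTriv [IsTopologicalGroup G] {σ : M → P.OrbitSpace H}
    (hσ : ∀ m, P.orbitProj H (σ m) = m) {e : Bundle.Trivialization G P.proj}
    (he : P.IsEquivariant e) {W : Set M} (hW : IsOpen W) (hWe : W ⊆ e.baseSet) {τ : M → G}
    (hτ : ContinuousOn τ W) (hτσ : ∀ m ∈ W, (τ m : G ⧸ H) = sectionCoset σ e m) :
    Bundle.Trivialization H (fun x : ReductionTotal σ => P.proj x.1) where
  -- Over `W` the membership in `H` is automatic; the value `1`, like the chosen point in `invFun`,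
  -- only fills in outside `W`.
  toFun x := (P.proj x.1, if h : (τ (P.proj x.1))⁻¹ * (e x.1).2 ∈ H then ⟨_, h⟩ else 1)
  invFun y := if h : y.1 ∈ W then
      ⟨e.toOpenPartialHomeomorph.symm (y.1, τ y.1 * y.2), by
        rw [e.proj_symm_apply' (hWe h)]
        exact eq_orbitMk_symm hσ he (hWe h)
          ((QuotientGroup.mk_mul_of_mem _ y.2.2).trans (hτσ _ h))⟩
    else (exists_reductionTotal hσ y.1).choose
  source := {x | P.proj x.1 ∈ W}
  target := W ×ˢ Set.univ
  map_source' x hx := ⟨hx, trivial⟩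
  map_target' := by
    rintro ⟨m, h⟩ ⟨hm : m ∈ W, -⟩
    simp [hm, e.proj_symm_apply' (hWe hm)]
  left_inv' x hx := by
    have hx' : P.proj x.1 ∈ W := hx
    have hxs := e.mem_source.2 (hWe hx')
    have hmem := inv_mul_mem_of_sectionCoset hσ he x hxs (hτσ _ hx')
    apply Subtype.ext
    simp only [hmem, hx', dif_pos, mul_inv_cancel_left]
    exact e.symm_apply_mk_proj hxs
  right_inv' := by
    rintro ⟨m, h⟩ ⟨hm : m ∈ W, -⟩
    simp [hm, e.proj_symm_apply' (hWe hm), e.apply_symm_apply' (hWe hm)]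
  open_source := hW.preimage (P.continuous_proj.comp continuous_subtype_val)
  open_target := hW.prod isOpen_univ
  continuousOn_toFun := by
    have hproj : Continuous fun x : ReductionTotal σ => P.proj x.1 :=
      P.continuous_proj.comp continuous_subtype_val
    refine hproj.continuousOn.prodMk (Topology.IsInducing.subtypeVal.continuousOn_iff.2 ?_)
    have key : ContinuousOn (fun x : ReductionTotal σ => (τ (P.proj x.1))⁻¹ * (e x.1).2)
        {x | P.proj x.1 ∈ W} := by
      refine (hτ.comp hproj.continuousOn fun x hx => hx).inv.mul ?_
      exact continuous_snd.comp_continuousOn (e.continuousOn_toFun.comp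
        continuous_subtype_val.continuousOn fun x hx => e.mem_source.2 (hWe hx))
    refine key.congr fun x hx => ?_
    have hmem := inv_mul_mem_of_sectionCoset hσ he x (e.mem_source.2 (hWe hx)) (hτσ _ hx)
    simp [hmem]
  continuousOn_invFun := by
    refine Topology.IsInducing.subtypeVal.continuousOn_iff.2 ?_
    have key : ContinuousOn
        (fun y : M × H => e.toOpenPartialHomeomorph.symm (y.1, τ y.1 * y.2))
        (W ×ˢ Set.univ) := by
      refine e.toOpenPartialHomeomorph.continuousOn_symm.comp
        (continuousOn_fst.prodMk ((hτ.comp continuousOn_fst fun y hy => hy.1).mul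
          (by fun_prop))) fun y hy => e.mem_target.2 (hWe hy.1)
    refine key.congr fun y hy => ?_
    have hy' : y.1 ∈ W := hy.1
    simp [hy']
  baseSet := W
  open_baseSet := hW
  source_eq := rfl
  target_eq := rfl
  proj_toFun _ _ := rfl

theorem coe_reductionTriv_snd [IsTopologicalGroup G] {σ : M → P.OrbitSpace H}
    (hσ : ∀ m, P.orbitProj H (σ m) = m) {e : Bundle.Trivialization G P.proj}
    (he : P.IsEquivariant e) {W : Set M} (hW : IsOpen W) (hWe : W ⊆ e.baseSet) {τ : M → G}
    (hτ : ContinuousOn τ W) (hτσ : ∀ m ∈ W, (τ m : G ⧸ H) = sectionCoset σ e m)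
    (x : ReductionTotal σ) (hx : P.proj x.1 ∈ W) :
    ((reductionTriv hσ he hW hWe hτ hτσ x).2 : G) = (τ (P.proj x.1))⁻¹ * (e x.1).2 := by
  have hmem := inv_mul_mem_of_sectionCoset hσ he x (e.mem_source.2 (hWe hx)) (hτσ _ hx)
  exact congrArg Subtype.val (dif_pos hmem)

/-- The principal `H`-bundle given by a section of `P/H → M`. -/
noncomputable def reduction [IsTopologicalGroup G] (hH : HasLocalSections H)
    (σ : C(M, P.OrbitSpace H)) (hσ : ∀ m, P.orbitProj H (σ m) = m) :
    PrincipalBundle.{u, v, w} M H where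
  Total := ReductionTotal σ
  proj x := P.proj x.1
  continuous_proj := P.continuous_proj.comp continuous_subtype_val
  surjective_proj := exists_reductionTotal hσ
  continuous_act := by
    refine Continuous.subtype_mk ?_ _
    exact P.continuous_act.comp
      (by fun_prop : Continuous fun x : ReductionTotal σ × H => (x.1.1, (x.2 : G)))
  free x h hx := Subtype.ext (P.free x.1 h (congrArg Subtype.val hx))
  proj_eq_iff x y := by
    constructor
    · intro h
      obtain ⟨g, hg⟩ := orbitMk_eq_iff.1 (x.2.symm.trans ((congrArg σ h).trans y.2))
      exact ⟨g, Subtype.ext hg⟩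
    · rintro ⟨g, rfl⟩
      exact (P.proj_act x.1 g).symm
  locally_trivial m := by
    obtain ⟨e, hm, he⟩ := P.locally_trivial m
    obtain ⟨W, hWe, hW, hmW, τ, hτ, hτσ⟩ := hH.exists_lift e.open_baseSet
      (continuousOn_sectionCoset σ.continuous hσ he) hm
    refine ⟨reductionTriv hσ he hW hWe hτ hτσ, hmW, fun x hx g => ?_⟩
    have hx' : P.proj x.1 ∈ W := hx
    apply Subtype.ext
    rw [Subgroup.coe_mul, coe_reductionTriv_snd hσ he hW hWe hτ hτσ x hx']
    refine (coe_reductionTriv_snd hσ he hW hWe hτ hτσ (MulOpposite.op g • x)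
      ((P.proj_act _ _).symm ▸ hx')).trans ?_
    change (τ (P.proj (MulOpposite.op (g : G) • x.1)))⁻¹ * (e (MulOpposite.op (g : G) • x.1)).2 = _
    rw [P.proj_act, he x.1 (e.mem_source.2 (hWe hx')), mul_assoc]

theorem HasGlobalSection.reducesTo [IsTopologicalGroup G] (hH : HasLocalSections H)
    (h : P.HasGlobalSection H) : P.ReducesTo H := by
  obtain ⟨σ, hσ⟩ := h
  exact ⟨reduction hH σ hσ, ⟨Subtype.val, continuous_subtype_val⟩, fun _ => rfl, fun _ _ => rfl⟩

theorem reducesTo_iff_hasGlobalSection [IsTopologicalGroup G] (hH : HasLocalSections H) :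
    P.ReducesTo H ↔ P.HasGlobalSection H :=
  ⟨ReducesTo.hasGlobalSection, HasGlobalSection.reducesTo hH⟩

end Reduction

end PrincipalBundle

namespace PrincipalBundle

open Filter

section Pullback

variable {M : Type u} [TopologicalSpace M] {G : Type v} [TopologicalSpace G] [Group G]
  {H : Subgroup G}

/-! ### Sections of the orbit space of a pull-back -/

theorem IsIso.symm {P : PrincipalBundle.{u, v, w} M G} {Q : PrincipalBundle.{u, v, w'} M G}
    (h : P.IsIso Q) : Q.IsIso P := by
  obtain ⟨φ, h1, h2⟩ := h
  refine ⟨φ.symm, fun q => by rw [← h1, φ.apply_symm_apply], fun q g => ?_⟩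
  rw [φ.symm_apply_eq, h2, φ.apply_symm_apply]

theorem HasGlobalSection.of_isIso {P : PrincipalBundle.{u, v, w} M G}
    {Q : PrincipalBundle.{u, v, w'} M G} (hs : P.HasGlobalSection H) (h : P.IsIso Q) :
    Q.HasGlobalSection H := by
  obtain ⟨φ, h1, h2⟩ := h
  obtain ⟨σ, hσ⟩ := hs
  let Φ : P.OrbitSpace H → Q.OrbitSpace H := Quotient.lift (Q.orbitMk H ∘ φ) (by
    intro p q hpq
    obtain ⟨g, rfl⟩ := orbitMk_eq_iff.1 (Quotient.sound hpq : P.orbitMk H p = P.orbitMk H q)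
    change Q.orbitMk H (φ p) = Q.orbitMk H (φ _)
    rw [h2, orbitMk_act])
  have hΦ : Continuous Φ := (continuous_orbitMk.comp φ.continuous).quotient_lift _
  refine ⟨⟨Φ ∘ σ, hΦ.comp σ.continuous⟩, fun m => ?_⟩
  obtain ⟨p, hp⟩ := orbitMk_surjective (σ m)
  have h3 := hσ m
  rw [← hp] at h3
  change Q.orbitProj H (Φ (σ m)) = m
  rw [← hp]
  exact (h1 p).trans h3

variable {N : Type u} [TopologicalSpace N]

/-- Sections of the orbit space of `f^* P` over `N` are the lifts of `f` to `P/H`. -/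
theorem hasGlobalSection_pullback_iff {P : PrincipalBundle.{u, v, w} M G} {f : C(N, M)} :
    (P.pullback f).HasGlobalSection H ↔ P.LiftsToOrbitSpace H f := by
  constructor
  · rintro ⟨σ, hσ⟩
    let Φ : (P.pullback f).OrbitSpace H → P.OrbitSpace H :=
      Quotient.lift (fun x : P.PullbackTotal f => P.orbitMk H x.1.1) (by
        intro p q hpq
        obtain ⟨g, rfl⟩ := orbitMk_eq_iff.1
          (Quotient.sound hpq : (P.pullback f).orbitMk H p = (P.pullback f).orbitMk H q)
        exact (orbitMk_act p.1.1 g).symm)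
    have hΦ : Continuous Φ := (continuous_orbitMk.comp
      (by fun_prop : Continuous fun x : P.PullbackTotal f => x.1.1)).quotient_lift _
    refine ⟨⟨Φ ∘ σ, hΦ.comp σ.continuous⟩, fun n => ?_⟩
    obtain ⟨p, hp⟩ := orbitMk_surjective (σ n)
    have h3 := hσ n
    rw [← hp] at h3
    change P.orbitProj H (Φ (σ n)) = f n
    rw [← hp]
    exact (show P.proj p.1.1 = f p.1.2 from p.2).trans (congrArg f h3)
  · rintro ⟨f', hf'⟩
    have hlift : ∀ n, ∃ x : P.PullbackTotal f, x.1.2 = n ∧ P.orbitMk H x.1.1 = f' n := by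
      intro n
      obtain ⟨p, hp⟩ := orbitMk_surjective (f' n)
      have h3 := hf' n
      rw [← hp] at h3
      exact ⟨⟨(p, n), h3⟩, rfl, hp⟩
    choose s hs hs' using hlift
    -- The representatives `s n` are arbitrary and need not vary continuously, but their orbits are
    -- determined by `f'`. Continuity at `n` is tested on representatives near `s n`, which exist
    -- because the orbit map of `P` is open.
    have key : ∀ x : P.PullbackTotal f, P.orbitMk H x.1.1 = f' x.1.2 →
        (P.pullback f).orbitMk H (s x.1.2) = (P.pullback f).orbitMk H x := by
      intro x hx
      obtain ⟨g, hg⟩ := orbitMk_eq_iff.1 ((hs' x.1.2).trans hx.symm)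
      exact orbitMk_eq_iff.2 ⟨g, Subtype.ext (Prod.ext hg (hs _))⟩
    refine ⟨⟨fun n => (P.pullback f).orbitMk H (s n), continuous_iff_continuousAt.2 fun n => ?_⟩,
      fun n => hs n⟩
    intro O hO
    have h1 : (P.pullback f).orbitMk H ⁻¹' O ∈ 𝓝 (s n) :=
      (continuous_orbitMk (P := P.pullback f) (H := H)).continuousAt hO
    obtain ⟨O', hO', hOO'⟩ := (mem_nhds_subtype _ (s n) _).1 h1
    obtain ⟨A, hA, B, hB, hAB⟩ := mem_nhds_prod_iff.1 hO'
    rw [hs] at hB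
    have hA' := (isOpenMap_orbitMk (H := H)).image_mem_nhds hA
    rw [hs'] at hA'
    change ∀ᶠ m in 𝓝 n, (P.pullback f).orbitMk H (s m) ∈ O
    filter_upwards [hB, f'.continuous.continuousAt hA'] with m hm hm'
    obtain ⟨p, hp, hpm⟩ := hm'
    have h3 := hf' m
    rw [← hpm] at h3
    let x : P.PullbackTotal f := ⟨(p, m), h3⟩
    rw [key x hpm]
    exact hOO' (show x.1 ∈ O' from hAB ⟨hp, hm⟩)

theorem hasGlobalSection_iff_liftsToOrbitSpace {B : Type v} [TopologicalSpace B] {M : Type v}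
    [TopologicalSpace M] {E : PrincipalBundle.{v, v, v} B G} {P : PrincipalBundle.{v, v, v} M G}
    {f : C(M, B)} (hf : E.IsClassifyingMap P f) :
    P.HasGlobalSection H ↔ E.LiftsToOrbitSpace H f := by
  rw [← hasGlobalSection_pullback_iff]
  exact ⟨fun h => h.of_isIso (IsIso.symm hf), fun h => h.of_isIso hf⟩

end Pullback

/-! ### Sections and the class in `H¹(M, G/H)` -/

section Cech

variable {M : Type u} [TopologicalSpace M] {G : Type v} [TopologicalSpace G] [Group G]
  [IsTopologicalGroup G] {P : PrincipalBundle.{u, v, w} M G} {H : Subgroup G} [H.Normal]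

/-- With `c k` the coset of the section in the `k`-th trivialization, the transition functions are
`c k * (c l)⁻¹` modulo `H`, so `b k = (c k)⁻¹` trivializes them. -/
theorem HasGlobalSection.map_cechClass (h : P.HasGlobalSection H) :
    CechH1.map (quotientHom H) P.cechClass = CechH1.trivialClass M (G ⧸ H) := by
  obtain ⟨σ, hσ⟩ := h
  let e : M → Bundle.Trivialization G P.proj := fun m => (P.locally_trivial m).choose
  have he : ∀ m, P.IsEquivariant (e m) := fun m => (P.locally_trivial m).choose_spec.2
  have hc : ∀ m, m ∈ (e m).baseSet := fun m => (P.locally_trivial m).choose_spec.1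
  refine Quotient.sound ⟨M, fun k => (e k).baseSet, id, fun _ => PUnit.unit,
    fun k m => (sectionCoset σ (e k) m)⁻¹, fun k => (e k).open_baseSet, fun m => ⟨m, hc m⟩,
    fun k => subset_rfl, fun k => Set.subset_univ _,
    fun k => (continuousOn_sectionCoset σ.continuous hσ (he k)).inv, ?_⟩
  rintro k l m ⟨hk, hl⟩
  obtain ⟨⟨p, hp⟩, hpm : P.proj p = m⟩ := exists_reductionTotal hσ m
  subst hpm
  change (1 : G ⧸ H) = (sectionCoset σ (e k) (P.proj p))⁻¹ *
    ((P.transition (e k) (e l) (P.proj p) : G) : G ⧸ H) *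
      ((sectionCoset σ (e l) (P.proj p))⁻¹)⁻¹
  rw [sectionCoset_proj hσ (he k) ((e k).mem_source.2 hk) hp,
    sectionCoset_proj hσ (he l) ((e l).mem_source.2 hl) hp,
    P.transition_proj (he k) (he l) hk hl, QuotientGroup.mk_mul, QuotientGroup.mk_inv]
  group

/-- The cosets `(b k)⁻¹` are the local expressions of one global section: the coboundary relation
says that they correspond under change of trivialization. -/
theorem hasGlobalSection_of_map_cechClass (hH : HasLocalSections H)
    (h : CechH1.map (quotientHom H) P.cechClass = CechH1.trivialClass M (G ⧸ H)) :
    P.HasGlobalSection H := by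
  obtain ⟨κ, W, r, r', b, hWo, hWc, hWr, -, hb, hcoc⟩ := Quotient.exact h
  let e : κ → Bundle.Trivialization G P.proj := fun k => (P.locally_trivial (r k)).choose
  have he : ∀ k, P.IsEquivariant (e k) := fun k => (P.locally_trivial (r k)).choose_spec.2
  have hWe : ∀ k, W k ⊆ (e k).baseSet := hWr
  have hcoc' : ∀ k l p, P.proj p ∈ W k → P.proj p ∈ W l →
      ((e k p).2 : G ⧸ H) = (b k (P.proj p))⁻¹ → ((e l p).2 : G ⧸ H) = (b l (P.proj p))⁻¹ := by
    intro k l p hk hl hp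
    have h1 : (1 : G ⧸ H) = b k (P.proj p) *
      ((P.transition (e k) (e l) (P.proj p) : G) : G ⧸ H) * (b l (P.proj p))⁻¹ :=
      hcoc k l (P.proj p) ⟨hk, hl⟩
    rw [P.transition_proj (he k) (he l) (hWe k hk) (hWe l hl), QuotientGroup.mk_mul,
      QuotientGroup.mk_inv, hp, mul_inv_cancel_left] at h1
    have h2 := congrArg (fun c => ((e l p).2 : G ⧸ H) * c) h1
    simpa using h2
  choose k hk using hWc
  have hrep : ∀ m, ∃ p, P.proj p = m ∧ ((e (k m) p).2 : G ⧸ H) = (b (k m) m)⁻¹ := by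
    intro m
    obtain ⟨g, hg⟩ := QuotientGroup.mk_surjective (b (k m) m)⁻¹
    have hm := hWe _ (hk m)
    exact ⟨(e (k m)).toOpenPartialHomeomorph.symm (m, g), (e (k m)).proj_symm_apply' hm,
      by rw [(e (k m)).apply_symm_apply' hm, hg]⟩
  choose s hs hs' using hrep
  have key : ∀ l p, P.proj p ∈ W l → ((e l p).2 : G ⧸ H) = (b l (P.proj p))⁻¹ →
      P.orbitMk H (s (P.proj p)) = P.orbitMk H p := by
    intro l p hl hp
    have h1 : s (P.proj p) ∈ (e l).source :=
      (e l).mem_source.2 (by rw [hs]; exact hWe l hl)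
    rw [orbitMk_eq_iff_of_isEquivariant (he l) h1 (hs _), hp]
    have h2 := hcoc' (k (P.proj p)) l (s (P.proj p))
    rw [hs] at h2
    exact h2 (hk _) hl (hs' _)
  refine ⟨⟨fun m => P.orbitMk H (s m), continuous_iff_continuousAt.2 fun m => ?_⟩, hs⟩
  -- The points `s m` were chosen without continuity. Near `m` the same orbits are represented by
  -- the continuous local section with coordinate `τ`, a lift of `(b (k m))⁻¹` to `G`.
  obtain ⟨V, hVW, hV, hmV, τ, hτ, hτb⟩ := hH.exists_lift (hWo (k m)) (hb (k m)).inv (hk m)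
  have h1 : ContinuousOn
      (fun n => P.orbitMk H ((e (k m)).toOpenPartialHomeomorph.symm (n, τ n))) V :=
    continuous_orbitMk.comp_continuousOn
      ((e (k m)).toOpenPartialHomeomorph.continuousOn_symm.comp (continuousOn_id.prodMk hτ)
        fun n hn => (e (k m)).mem_target.2 (hWe _ (hVW hn)))
  refine ContinuousOn.continuousAt (h1.congr fun n hn => ?_) (hV.mem_nhds hmV)
  have hn' := hWe _ (hVW hn)
  have h2 := key (k m) ((e (k m)).toOpenPartialHomeomorph.symm (n, τ n))
  rw [(e (k m)).proj_symm_apply' hn', (e (k m)).apply_symm_apply' hn'] at h2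
  exact h2 (hVW hn) (hτb n hn)

end Cech

end PrincipalBundle

theorem theorem2
    -- a Banach Lie group `G`
    {E : Type*} [NormedAddCommGroup E] [NormedSpace ℝ E] [CompleteSpace E]
    {G : Type u} [TopologicalSpace G] [ChartedSpace E G] [Group G] [IsTopologicalGroup G]
    [LieGroup 𝓘(ℝ, E) ∞ G]
    -- a closed Banach Lie subgroup `H`
    {F : Type*} [NormedAddCommGroup F] [NormedSpace ℝ F] [CompleteSpace F]
    (H : Subgroup G) [ChartedSpace F H]
    (hH : IsClosedBanachLieSubgroup (E := E) (F := F) H)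
    -- a principal `G`-bundle `P` over a topological space `M`
    {M : Type u} [TopologicalSpace M] (P : PrincipalBundle.{u, u, u} M G) :
    (P.ReducesTo H ↔ P.HasGlobalSection H) ∧
    (∀ (BG : Type u) [TopologicalSpace BG] (EG : PrincipalBundle.{u, u, u} BG G),
      EG.IsClassifyingSpace → ∀ f : C(M, BG), EG.IsClassifyingMap P f →
        (P.ReducesTo H ↔ EG.LiftsToOrbitSpace H f)) ∧
    (∀ [H.Normal],
      P.ReducesTo H ↔
        CechH1.map (quotientHom H) P.cechClass = CechH1.trivialClass M (G ⧸ H)) := by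
  have hs := hasLocalSections_of_isClosedBanachLieSubgroup H hH
  have h1 := PrincipalBundle.reducesTo_iff_hasGlobalSection (P := P) hs
  refine ⟨h1, fun BG _ EG _ f hf => ?_, ?_⟩
  · rw [h1]
    exact PrincipalBundle.hasGlobalSection_iff_liftsToOrbitSpace hf
  · intro _
    rw [h1]
    exact ⟨fun h => h.map_cechClass, PrincipalBundle.hasGlobalSection_of_map_cechClass hs⟩
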